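/- Let $(\Sigma_1,\gamma_1)$ and $(\Sigma_2,\gamma_2)$ be nonempty closed (compact, without boundary) smooth Riemannian manifolds of dimensions $n_1,n_2\ge 1$, put $n=n_1+n_2+1$, and suppose that both are Einstein with Einstein constant $n-2$, i.e. $\mathrm{Rc}(\gamma_i)=(n-2)\gamma_i$ for $i=1,2$. If $n<10$, then the $n$-dimensional cone $$C(\Sigma_1\times\Sigma_2)=\bigl((0,\infty)\times\Sigma_1\times\Sigma_2,\; g=dr^2+r^2(\gamma_1+\gamma_2)\bigr)$$ is Ricci-flat and unstable. Here a Ricci-flat manifold or cone $(M,g)$ is called stable if $$\int_M 2\,\mathrm{Rm}(h,h)\,dV_g\le\int_M|\nabla h|^2\,dV_g$$ for all smooth symmetric 2-tensors $h$ on $M$ with compact support (for a cone: supported away from the tip) that are transverse, i.e. $\nabla_i h_{ij}=0$; it is unstable if it is not stable. Moreover $\mathrm{Rm}(h,h)=R_{ijkl}h_{ik}h_{jl}$ in an orthonormal frame, with the sign convention that $R_{ijij}$ (no sum) is the sectional curvature. -/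

import Mathlib

open Bundle MeasureTheory
open scoped Manifold ContDiff

noncomputable section

namespace RiemannianCone

/-! ### Contractions and curvature in one coordinate chart

Here `E` is the model vector space of a chart, `G y u v` is a metric in coordinates (the bilinear
form at the point `y : E`, applied to the vectors `u v : E`), and `H y u v` is a 2-tensor in
coordinates.  A fixed basis of `E` is used to write sums over indices; the values of `contract` do
not depend on it. -/

section Coordinates

variable {E : Type*} [NormedAddCommGroup E] [NormedSpace ℝ E] [FiniteDimensional ℝ E]

/-- The matrix `B_{ij}` of a bilinear form in the fixed basis of `E`. -/
def gram (B : E → E → ℝ) :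
    Matrix (Fin (Module.finrank ℝ E)) (Fin (Module.finrank ℝ E)) ℝ :=
  Matrix.of fun i j => B (Module.finBasis ℝ E i) (Module.finBasis ℝ E j)

/-- Metric contraction `B^{ij} F(e_i, e_j)` of a bilinear map `F` with the inverse of `B`.  For an
inner product `B` this is the sum of `F(e_i, e_i)` over a `B`-orthonormal basis. -/
def contract {V : Type*} [AddCommGroup V] [Module ℝ V] (B : E → E → ℝ) (F : E → E → V) : V :=
  ∑ i, ∑ j, (gram B)⁻¹ i j • F (Module.finBasis ℝ E i) (Module.finBasis ℝ E j)

/-- Christoffel symbols of the first kind,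
`(∂_u G(v,w) + ∂_v G(u,w) - ∂_w G(u,v)) / 2`. -/
def christoffelFirst (G : E → E → E → ℝ) (y u v w : E) : ℝ :=
  (fderiv ℝ (fun z => G z v w) y u + fderiv ℝ (fun z => G z u w) y v
    - fderiv ℝ (fun z => G z u v) y w) / 2

/-- Christoffel symbols of the second kind, as the vector `Γ(u,v)` with components
`Γ^k(u,v) = G^{kl} Γ_l(u,v)`. -/
def christoffel (G : E → E → E → ℝ) (y u v : E) : E :=
  contract (G y) fun k l => christoffelFirst G y u v l • k

/-- The curvature `R(u,v)w = ∇_u ∇_v w - ∇_v ∇_u w` for constant coordinate fields `u, v, w`. -/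
def curvature (G : E → E → E → ℝ) (y u v w : E) : E :=
  fderiv ℝ (fun z => christoffel G z v w) y u - fderiv ℝ (fun z => christoffel G z u w) y v
    + christoffel G y u (christoffel G y v w) - christoffel G y v (christoffel G y u w)

/-- The covariant derivative `(∇_u H)(v,w)` of a 2-tensor `H`, for the Levi-Civita connection
of `G`. -/
def covariantDeriv (G H : E → E → E → ℝ) (y u v w : E) : ℝ :=
  fderiv ℝ (fun z => H z v w) y u
    - H y (christoffel G y u v) w - H y v (christoffel G y u w)

end Coordinates

/-! ### Riemannian geometry on a manifold without boundary -/

section Manifold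

variable {E : Type*} [NormedAddCommGroup E] [NormedSpace ℝ E] [FiniteDimensional ℝ E]
  {H : Type*} [TopologicalSpace H] (I : ModelWithCorners ℝ E H)
  {M : Type*} [TopologicalSpace M] [ChartedSpace H M]

/-- Fields of bilinear forms on the tangent spaces of `M` (no regularity imposed). -/
abbrev TensorField (M : Type*) [TopologicalSpace M] [ChartedSpace H M] :=
  ∀ x : M, TangentSpace I x →L[ℝ] TangentSpace I x →L[ℝ] ℝ

variable {I}

/-- The components of `T` in the preferred chart `φ` at `p`: the pull-back of `T` under `φ⁻¹`. -/
def inChart (T : TensorField I M) (p : M) (y u v : E) : ℝ :=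
  T ((extChartAt I p).symm y)
    (mfderivWithin 𝓘(ℝ, E) I (extChartAt I p).symm (Set.range I) y u)
    (mfderivWithin 𝓘(ℝ, E) I (extChartAt I p).symm (Set.range I) y v)

/-! The tangent space at `p` is `E`, identified through the preferred chart at `p`; so tensors
at `p` are given by their components in that chart. -/

/-- A 2-tensor at `p`, as a function on `E × E`. -/
def formAt (g : TensorField I M) (p : M) (u v : E) : ℝ := g p u v

/-- The Riemann tensor `Rm(u,v,w,z) = g(R(u,v)z, w)` at `p`.  The sign is such that
`Rm(u,v,u,v)` is the sectional curvature of orthonormal `u, v`. -/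
def riemann (g : TensorField I M) (p : M) (u v w z : E) : ℝ :=
  formAt g p (curvature (inChart g p) (extChartAt I p p) u v z) w

/-- The Ricci tensor `Rc_{jl} = g^{ik} R_{ijkl}` at `p`. -/
def ricci (g : TensorField I M) (p : M) (v z : E) : ℝ :=
  contract (formAt g p) fun u w => riemann g p u v w z

/-- `Rc(g) = c g`. -/
def IsEinstein (g : TensorField I M) (c : ℝ) : Prop :=
  ∀ (p : M) (v w : E), ricci g p v w = c * formAt g p v w

/-- `Rc(g) = 0`. -/
def IsRicciFlat (g : TensorField I M) : Prop :=
  ∀ (p : M) (v w : E), ricci g p v w = 0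

/-- The covariant derivative `(∇_u h)(v,w)` at `p`. -/
def nabla (g h : TensorField I M) (p : M) (u v w : E) : ℝ :=
  covariantDeriv (inChart g p) (inChart h p) (extChartAt I p p) u v w

/-- `|∇h|²` at `p`: all three indices are contracted. -/
def normSqNabla (g h : TensorField I M) (p : M) : ℝ :=
  contract (formAt g p) fun u u' => contract (formAt g p) fun v v' =>
    contract (formAt g p) fun w w' => nabla g h p u v w * nabla g h p u' v' w'

/-- `Rm(h,h) = R_{ijkl} h_{ik} h_{jl}` at `p`, with repeated indices contracted by the metric. -/
def rmQuadratic (g h : TensorField I M) (p : M) : ℝ :=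
  contract (formAt g p) fun i i' => contract (formAt g p) fun j j' =>
    contract (formAt g p) fun k k' => contract (formAt g p) fun l l' =>
      riemann g p i j k l * formAt h p i' k' * formAt h p j' l'

/-- `∇_i h_{ij} = 0`. -/
def IsTransverse (g h : TensorField I M) : Prop :=
  ∀ (p : M) (w : E), contract (formAt g p) (fun u v => nabla g h p u v w) = 0

/-- Smooth symmetric 2-tensors with compact support. -/
structure IsVariation [IsManifold I 1 M] (h : TensorField I M) : Prop where
  smooth : ContMDiff I (I.prod 𝓘(ℝ, E →L[ℝ] E →L[ℝ] ℝ)) ∞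
    (fun x => TotalSpace.mk' (E →L[ℝ] E →L[ℝ] ℝ)
      (E := fun x : M => TangentSpace I x →L[ℝ] TangentSpace I x →L[ℝ] ℝ) x (h x))
  symm : ∀ (x : M) (u v : TangentSpace I x), h x u v = h x v u
  compactSupport : IsCompact (closure {x : M | h x ≠ 0})

variable [MeasurableSpace E] [BorelSpace E] [MeasurableSpace M]

/-- `μ` is the Riemannian volume measure of `g`: in each preferred chart, it is
`√(det g_{ij}) dx`.  (Here `addHaar` is the Lebesgue measure normalized by the basis in which the
components `g_{ij}` are taken.)  On a second countable manifold there is exactly one such Borel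
measure. -/
def IsRiemannianVolume (g : TensorField I M) (μ : Measure M) : Prop :=
  ∀ (p : M) (s : Set M), MeasurableSet s → s ⊆ (chartAt H p).source →
    μ s = ∫⁻ y in extChartAt I p '' s,
      ENNReal.ofReal (Real.sqrt (gram (inChart g p y)).det) ∂(Module.finBasis ℝ E).addHaar

open Classical in
/-- The Riemannian volume measure. -/
def riemannianVolume (g : TensorField I M) : Measure M :=
  if hμ : ∃ μ : Measure M, IsRiemannianVolume g μ then hμ.choose else 0

/-- The stability inequality `∫ 2 Rm(h,h) ≤ ∫ |∇h|²` for all transverse symmetric 2-tensors with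
compact support. -/
def IsStable [IsManifold I 1 M] (g : TensorField I M) : Prop :=
  ∀ h : TensorField I M, IsVariation h → IsTransverse g h →
    ∫ x, 2 * rmQuadratic g h x ∂(riemannianVolume g)
      ≤ ∫ x, normSqNabla g h x ∂(riemannianVolume g)

end Manifold

/-! ### Products and cones -/

section Constructions

variable {E₁ : Type*} [NormedAddCommGroup E₁] [NormedSpace ℝ E₁]
  {H₁ : Type*} [TopologicalSpace H₁] {I₁ : ModelWithCorners ℝ E₁ H₁}
  {M₁ : Type*} [TopologicalSpace M₁] [ChartedSpace H₁ M₁]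
  {E₂ : Type*} [NormedAddCommGroup E₂] [NormedSpace ℝ E₂]
  {H₂ : Type*} [TopologicalSpace H₂] {I₂ : ModelWithCorners ℝ E₂ H₂}
  {M₂ : Type*} [TopologicalSpace M₂] [ChartedSpace H₂ M₂]

/-- Pull-back of a bilinear form under a linear map. -/
def pullbackForm {E F : Type*} [NormedAddCommGroup E] [NormedSpace ℝ E]
    [NormedAddCommGroup F] [NormedSpace ℝ F]
    (B : F →L[ℝ] F →L[ℝ] ℝ) (A : E →L[ℝ] F) : E →L[ℝ] E →L[ℝ] ℝ :=
  B.bilinearComp A A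

/-- The product metric `γ₁ + γ₂` on `M₁ × M₂`. -/
def productMetric (γ₁ : TensorField I₁ M₁) (γ₂ : TensorField I₂ M₂) :
    TensorField (I₁.prod I₂) (M₁ × M₂) := fun x =>
  pullbackForm (E := E₁ × E₂) (F := E₁) (γ₁ x.1) (ContinuousLinearMap.fst ℝ E₁ E₂)
    + pullbackForm (E := E₁ × E₂) (F := E₂) (γ₂ x.2) (ContinuousLinearMap.snd ℝ E₁ E₂)

theorem productMetric_apply (γ₁ : TensorField I₁ M₁) (γ₂ : TensorField I₂ M₂) (x : M₁ × M₂)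
    (u v : E₁ × E₂) :
    productMetric γ₁ γ₂ x u v = γ₁ x.1 u.1 v.1 + γ₂ x.2 u.2 v.2 := rfl

/-- The open half-line `ℝ₊ = (0, ∞)`. -/
def posReals : TopologicalSpace.Opens ℝ := ⟨Set.Ioi 0, isOpen_Ioi⟩

/-- The manifold `ℝ₊ × M` underlying the cone over `M` (without the tip). -/
abbrev Cone (M : Type*) := posReals × M

/-- The cone metric `dr² + r² γ` on `ℝ₊ × M`. -/
def coneMetric (γ : TensorField I₁ M₁) : TensorField (𝓘(ℝ, ℝ).prod I₁) (Cone M₁) := fun x =>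
  pullbackForm (E := ℝ × E₁) (F := ℝ) (ContinuousLinearMap.mul ℝ ℝ)
      (ContinuousLinearMap.fst ℝ ℝ E₁)
    + (x.1 : ℝ) ^ 2 •
      pullbackForm (E := ℝ × E₁) (F := E₁) (γ x.2) (ContinuousLinearMap.snd ℝ ℝ E₁)

theorem coneMetric_apply (γ : TensorField I₁ M₁) (x : Cone M₁) (u v : ℝ × E₁) :
    coneMetric γ x u v = u.1 * v.1 + (x.1 : ℝ) ^ 2 * γ x.2 u.2 v.2 := rfl

end Constructions

end RiemannianCone

end

/-!
The link `Σ = Σ₁ × Σ₂` is Einstein with constant `n - 2 = dim Σ - 1`.  By the Gauss equation of a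
cone (`curvature_cone`), radial directions are flat, and the curvature of `C(Σ)` is that of `Σ`
minus that of a unit sphere; so the cone over `Σ` is Ricci-flat (`isRicciFlat_coneMetric`).

The product structure of the link provides a destabilizing direction: let one factor grow while
the other one shrinks.  The tensor `k = n₂ γ₁ - n₁ γ₂` is parallel and trace-free, it has constant
norm, and, both factors being Einstein with the same constant, `Rm(k, k) = (n - 2) |k|²`
(`rmQuadratic_productTensor`).  Put `h = f(r) k`.  Since `k` is parallel and trace-free, `h` is
transverse (`divergence_radialTensor`), and pointwise, with `φ = f / r²`,
`Rm(h, h) = (n - 1) (φ / r)² |k|²` and `|∇h|² = (φ'² + 2 (φ / r)²) |k|²`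
(`rmQuadratic_radialTensor`, `normSqNabla_radialTensor`).

The volume of a cone over a compact link is a multiple of `r ^ (n - 1) dr` on radial functions
(`exists_integral_cone_eq`), so stability would imply, for all `φ` with compact support in `(0, ∞)`,
`2 (n - 2) ∫ φ² r ^ (n - 3) dr ≤ ∫ φ'² r ^ (n - 1) dr`.
This contradicts the sharpness of the Hardy inequality, whose constant is `(n - 2)² / 4`, because
`(n - 2)² / 4 < 2 (n - 2)` exactly if `2 < n < 10`.  A near-optimal `φ` is `r ^ (-(n - 2) / 2)`
times a wide bump function of `log r` (`exists_profile`).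

Two points are matters of encoding.  Contractions are defined by the inverse Gram matrix of a fixed
basis; they are evaluated as sums over an orthonormal frame (`IsFrame.contract_eq`).  The
Riemannian volume is defined through its values in charts; by the change of variables formula the
chart densities agree on overlaps, and they are glued along a countable partition into Borel sets
that lie in charts (`isRiemannianVolume_riemannianVolume`).
-/

open Bundle MeasureTheory
open scoped Manifold ContDiff

noncomputable section

set_option maxSynthPendingDepth 3

namespace RiemannianCone

/-! ### Metric contractions and frames -/

section Frames

variable {E : Type*} [NormedAddCommGroup E] [NormedSpace ℝ E]
  {ι : Type*} [Fintype ι]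

/-- A finite family `e` with `v = ∑ᵢ B(eᵢ, v) eᵢ` for all `v`.  For an inner product `B` the
`B`-orthonormal bases have this property, which is all that is needed to evaluate contractions. -/
def IsFrame (B : E →L[ℝ] E →L[ℝ] ℝ) (e : ι → E) : Prop :=
  ∀ v, ∑ i, B (e i) v • e i = v

theorem IsFrame.sum_mul {B : E →L[ℝ] E →L[ℝ] ℝ} {e : ι → E} (he : IsFrame B e)
    (L : E → ℝ) (hL : IsLinearMap ℝ L) (v : E) : ∑ i, B (e i) v * L (e i) = L v := by
  conv_rhs => rw [← he v]
  change _ = hL.mk' L _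
  simp

/-- A contraction is the sum over a frame: if `Q` is the coordinate matrix of the frame in the
fixed basis, then `Q Qᵀ` is the inverse of the Gram matrix. -/
theorem IsFrame.contract_eq [FiniteDimensional ℝ E] {V : Type*} [AddCommGroup V] [Module ℝ V]
    {B : E →L[ℝ] E →L[ℝ] ℝ} {e : ι → E} (he : IsFrame B e)
    (F : E → E → V)
    (h₁ : ∀ v, IsLinearMap ℝ fun u => F u v) (h₂ : ∀ u, IsLinearMap ℝ (F u)) :
    contract (fun u v => B u v) F = ∑ i, F (e i) (e i) := by
  classical
  set b := Module.finBasis ℝ E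
  let Q : Matrix (Fin (Module.finrank ℝ E)) ι ℝ := Matrix.of fun i a => b.repr (e a) i
  have hQ : ∀ a, ∑ i, Q i a • b i = e a := fun a => b.sum_repr (e a)
  have hinv : (gram fun u v => B u v)⁻¹ = Q * Q.transpose := by
    apply Matrix.inv_eq_left_inv
    ext i j
    have h1 : ∀ a, (Q.transpose * gram fun u v => B u v) a j = B (e a) (b j) := by
      intro a
      rw [Matrix.mul_apply, ← hQ a]
      simp [gram, b]
    have h2 : (1 : Matrix _ _ ℝ) i j = b.repr (b j) i := by
      rw [b.repr_self, Finsupp.single_apply, Matrix.one_apply]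
      simp only [eq_comm]
    rw [Matrix.mul_assoc, Matrix.mul_apply, h2]
    conv_rhs => rw [← he (b j)]
    simp only [h1, map_sum, map_smul, Finsupp.coe_finsetSum, Finset.sum_apply, Finsupp.smul_apply,
      smul_eq_mul]
    exact Finset.sum_congr rfl fun a _ => by simp [Q, mul_comm]
  have h3 : ∀ a, F (e a) (e a) = ∑ i, ∑ j, (Q i a * Q j a) • F (b i) (b j) := by
    intro a
    have e1 : ∀ v, F (e a) v = ∑ i, Q i a • F (b i) v := fun v => by
      conv_lhs => rw [← hQ a]
      change (h₁ v).mk' _ _ = _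
      simp
    have e2 : ∀ u, F u (e a) = ∑ j, Q j a • F u (b j) := fun u => by
      conv_lhs => rw [← hQ a]
      change (h₂ u).mk' _ _ = _
      simp
    rw [e1]
    refine Finset.sum_congr rfl fun i _ => ?_
    rw [e2, Finset.smul_sum]
    simp only [smul_smul]
  simp only [h3]
  rw [contract, Finset.sum_comm]
  simp_rw [Finset.sum_comm (s := (Finset.univ : Finset ι))]
  rw [Finset.sum_comm]
  refine Finset.sum_congr rfl fun i _ => Finset.sum_congr rfl fun j _ => ?_
  rw [hinv, Matrix.mul_apply, Finset.sum_smul]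
  rfl

/-- The trace of the identity, computed in a frame. -/
theorem IsFrame.sum_self [FiniteDimensional ℝ E]
    {B : E →L[ℝ] E →L[ℝ] ℝ} {e : ι → E} (he : IsFrame B e) :
    ∑ i, B (e i) (e i) = Module.finrank ℝ E := by
  have h := LinearMap.trace_id ℝ E
  have hid : (LinearMap.id : E →ₗ[ℝ] E)
      = ∑ i, (B (e i)).toLinearMap.smulRight (e i) := by
    ext v
    simp [he v]
  rw [hid, map_sum] at h
  simpa using h

/-- Normalizing an orthogonal basis gives a frame. -/
theorem exists_isFrame [FiniteDimensional ℝ E] (B : E →L[ℝ] E →L[ℝ] ℝ)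
    (hs : ∀ u v, B u v = B v u) (hp : ∀ v, v ≠ 0 → 0 < B v v) :
    ∃ e : Fin (Module.finrank ℝ E) → E, IsFrame B e := by
  let B' : LinearMap.BilinForm ℝ E := LinearMap.mk₂ ℝ (fun u v => B u v)
    (by simp) (by simp) (by simp) (by simp)
  have hsym : LinearMap.IsSymm B' := ⟨fun u v => by simp [B', hs u v]⟩
  obtain ⟨v, hv⟩ := LinearMap.BilinForm.exists_orthogonal_basis hsym
  have hv' : ∀ i j, i ≠ j → B (v i) (v j) = 0 := fun i j hij => by
    simpa [B', LinearMap.IsOrthoᵢ, LinearMap.isOrthoᵢ_def] using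
      (LinearMap.isOrthoᵢ_def.1 hv) i j hij
  have hpos : ∀ i, 0 < B (v i) (v i) := fun i => hp _ (v.ne_zero i)
  refine ⟨fun i => (Real.sqrt (B (v i) (v i)))⁻¹ • v i, fun w => ?_⟩
  have hw : ∀ i, B (v i) w = v.repr w i * B (v i) (v i) := by
    intro i
    conv_lhs => rw [← v.sum_repr w]
    rw [map_sum, Finset.sum_eq_single i]
    · simp
    · intro j _ hj
      simp [hv' i j (Ne.symm hj)]
    · simp
  conv_rhs => rw [← v.sum_repr w]
  refine Finset.sum_congr rfl fun i _ => ?_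
  have hsq : Real.sqrt (B (v i) (v i)) ≠ 0 := (Real.sqrt_pos.2 (hpos i)).ne'
  rw [smul_smul]
  congr 1
  simp only [map_smul, _root_.smul_apply, smul_eq_mul, hw]
  field_simp
  rw [Real.sq_sqrt (hpos i).le, mul_comm]

end Frames

/-! ### Metrics in a chart: Christoffel symbols and curvature as bundled maps -/

section Chart

variable {E : Type*} [NormedAddCommGroup E] [NormedSpace ℝ E]

/-- A smooth Riemannian metric on an open subset of the model space. -/
structure IsMetricOn (G : E → E →L[ℝ] E →L[ℝ] ℝ) (U : Set E) : Prop where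
  isOpen : IsOpen U
  contDiffOn : ContDiffOn ℝ ∞ G U
  symm : ∀ y ∈ U, ∀ u v, G y u v = G y v u
  pos : ∀ y ∈ U, ∀ v, v ≠ 0 → 0 < G y v v

/-- `christoffelFirst` as a continuous trilinear map. -/
def christoffelFirstL (G : E → E →L[ℝ] E →L[ℝ] ℝ) (y : E) : E →L[ℝ] E →L[ℝ] E →L[ℝ] ℝ :=
  (1 / 2 : ℝ) • (fderiv ℝ G y + (fderiv ℝ G y).flip
    - (ContinuousLinearMap.flipₗᵢ ℝ E E ℝ).toContinuousLinearEquiv.toContinuousLinearMap ∘L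
      (fderiv ℝ G y).flip)

theorem christoffelFirstL_apply (G : E → E →L[ℝ] E →L[ℝ] ℝ) (y u v w : E) :
    christoffelFirstL G y u v w
      = (fderiv ℝ G y u v w + fderiv ℝ G y v u w - fderiv ℝ G y w u v) / 2 := by
  simp [christoffelFirstL]
  ring

/-- `christoffel` as a continuous bilinear map: the index of `christoffelFirstL` is raised by the
inverse of the metric. -/
def christoffelL (G : E → E →L[ℝ] E →L[ℝ] ℝ) (y : E) : E →L[ℝ] E →L[ℝ] E :=
  (ContinuousLinearMap.compL ℝ E (E →L[ℝ] ℝ) E (G y).inverse) ∘L (christoffelFirstL G y)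

variable {G : E → E →L[ℝ] E →L[ℝ] ℝ} {U : Set E} {y : E}

namespace IsMetricOn

theorem differentiableAt (hG : IsMetricOn G U) (hy : y ∈ U) : DifferentiableAt ℝ G y :=
  (hG.contDiffOn.contDiffAt (hG.isOpen.mem_nhds hy)).differentiableAt (by simp)

theorem fderiv_apply (hG : IsMetricOn G U) (hy : y ∈ U) (u v w : E) :
    fderiv ℝ (fun z => G z v w) y u = fderiv ℝ G y u v w := by
  have h := hG.differentiableAt hy
  rw [fderiv_clm_apply (by fun_prop) (by fun_prop), fderiv_clm_apply (by fun_prop) (by fun_prop)]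
  simp

theorem fderiv_symm (hG : IsMetricOn G U) (hy : y ∈ U) (u v w : E) :
    fderiv ℝ G y u v w = fderiv ℝ G y u w v := by
  rw [← hG.fderiv_apply hy, ← hG.fderiv_apply hy]
  congr 1
  apply Filter.EventuallyEq.fderiv_eq
  filter_upwards [hG.isOpen.mem_nhds hy] with z hz using hG.symm z hz v w

theorem christoffelFirst_eq (hG : IsMetricOn G U) (hy : y ∈ U) (u v w : E) :
    christoffelFirst (fun y u v => G y u v) y u v w = christoffelFirstL G y u v w := by
  rw [christoffelFirst, christoffelFirstL_apply]
  simp only [hG.fderiv_apply hy]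

theorem eq_of_forall (hG : IsMetricOn G U) (hy : y ∈ U) {a b : E}
    (h : ∀ w, G y a w = G y b w) : a = b := by
  by_contra hab
  have := hG.pos y hy (a - b) (sub_ne_zero.2 hab)
  simp [h] at this

variable [FiniteDimensional ℝ E]

theorem exists_frame (hG : IsMetricOn G U) (hy : y ∈ U) :
    ∃ e : Fin (Module.finrank ℝ E) → E, IsFrame (G y) e :=
  exists_isFrame _ (hG.symm y hy) (hG.pos y hy)

theorem exists_equiv (hG : IsMetricOn G U) (hy : y ∈ U) :
    ∃ e : E ≃L[ℝ] (E →L[ℝ] ℝ), (e : E →L[ℝ] E →L[ℝ] ℝ) = G y := by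
  have hinj : Function.Injective (G y) := fun a b h => hG.eq_of_forall hy fun w => by rw [h]
  have hdim : Module.finrank ℝ E = Module.finrank ℝ (E →L[ℝ] ℝ) := by
    rw [← LinearMap.toContinuousLinearMap.finrank_eq]
    exact (Subspace.dual_finrank_eq).symm
  let e := LinearEquiv.ofInjectiveOfFinrankEq (G y).toLinearMap hinj hdim
  exact ⟨e.toContinuousLinearEquiv, by ext; rfl⟩

theorem apply_inverse (hG : IsMetricOn G U) (hy : y ∈ U) (L : E →L[ℝ] ℝ) :
    G y ((G y).inverse L) = L := by
  obtain ⟨e, he⟩ := hG.exists_equiv hy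
  rw [← he]
  simp

theorem apply_christoffelL (hG : IsMetricOn G U) (hy : y ∈ U) (u v w : E) :
    G y (christoffelL G y u v) w = christoffelFirstL G y u v w := by
  change G y ((G y).inverse (christoffelFirstL G y u v)) w = _
  rw [hG.apply_inverse hy]

theorem christoffel_eq (hG : IsMetricOn G U) (hy : y ∈ U) (u v : E) :
    christoffel (fun y u v => G y u v) y u v = christoffelL G y u v := by
  obtain ⟨e, he⟩ := hG.exists_frame hy
  rw [christoffel, he.contract_eq]
  · simp only [hG.christoffelFirst_eq hy, ← hG.apply_christoffelL hy]
    rw [← he (christoffelL G y u v)]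
    simp only [he (christoffelL G y u v), hG.symm y hy (christoffelL G y u v)]
  · exact fun v => ⟨fun _ _ => smul_add _ _ _, fun _ _ => smul_comm _ _ _⟩
  · intro v
    constructor <;> intros <;> simp [hG.christoffelFirst_eq hy, add_smul, mul_smul]

/-- The Levi-Civita connection is characterized by the Koszul formula. -/
theorem christoffelL_eq_of_forall (hG : IsMetricOn G U) (hy : y ∈ U) {u v a : E}
    (h : ∀ w, G y a w = christoffelFirstL G y u v w) : christoffelL G y u v = a :=
  hG.eq_of_forall hy fun w => by rw [hG.apply_christoffelL hy, h]

theorem christoffelL_symm (hG : IsMetricOn G U) (hy : y ∈ U) (u v : E) :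
    christoffelL G y u v = christoffelL G y v u :=
  hG.eq_of_forall hy fun w => by
    rw [hG.apply_christoffelL hy, hG.apply_christoffelL hy, christoffelFirstL_apply,
      christoffelFirstL_apply, hG.fderiv_symm hy w]
    ring

theorem contDiffOn_christoffelL (hG : IsMetricOn G U) : ContDiffOn ℝ ∞ (christoffelL G) U := by
  have hD : ContDiffOn ℝ ∞ (fderiv ℝ G) U := hG.contDiffOn.fderiv_of_isOpen hG.isOpen le_rfl
  have hF : ContDiffOn ℝ ∞ (christoffelFirstL G) U := by
    refine contDiffOn_clm_apply.2 fun u => contDiffOn_clm_apply.2 fun v =>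
      contDiffOn_clm_apply.2 fun w => ?_
    simp_rw [christoffelFirstL_apply]
    have h : ∀ a b c : E, ContDiffOn ℝ ∞ (fun y => fderiv ℝ G y a b c) U := fun a b c =>
      ((hD.clm_apply contDiffOn_const).clm_apply contDiffOn_const).clm_apply contDiffOn_const
    exact (((h u v w).add (h v u w)).sub (h w u v)).div_const 2
  have hI : ContDiffOn ℝ ∞ (fun y => (G y).inverse) U := by
    intro y hy
    obtain ⟨e, he⟩ := hG.exists_equiv hy
    have : CompleteSpace E := FiniteDimensional.complete ℝ E
    have h1 := contDiffAt_map_inverse (n := ∞) e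
    rw [he] at h1
    exact (h1.comp_contDiffWithinAt y (hG.contDiffOn y hy) : _)
  refine contDiffOn_clm_apply.2 fun u => contDiffOn_clm_apply.2 fun v => ?_
  change ContDiffOn ℝ ∞ (fun y => (G y).inverse (christoffelFirstL G y u v)) U
  exact hI.clm_apply ((hF.clm_apply contDiffOn_const).clm_apply contDiffOn_const)

theorem differentiableAt_christoffelL (hG : IsMetricOn G U) (hy : y ∈ U) :
    DifferentiableAt ℝ (christoffelL G) y :=
  (hG.contDiffOn_christoffelL.contDiffAt (hG.isOpen.mem_nhds hy)).differentiableAt (by simp)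

theorem curvature_eq (hG : IsMetricOn G U) (hy : y ∈ U) (u v w : E) :
    curvature (fun y u v => G y u v) y u v w
      = fderiv ℝ (christoffelL G) y u v w - fderiv ℝ (christoffelL G) y v u w
        + christoffelL G y u (christoffelL G y v w)
        - christoffelL G y v (christoffelL G y u w) := by
  have h : ∀ v w, fderiv ℝ (fun z => christoffel (fun y u v => G y u v) z v w) y
      = fderiv ℝ (fun z => christoffelL G z v w) y := fun v w => by
    apply Filter.EventuallyEq.fderiv_eq
    filter_upwards [hG.isOpen.mem_nhds hy] with z hz using hG.christoffel_eq hz v w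
  have h' : ∀ u v w, fderiv ℝ (fun z => christoffelL G z v w) y u
      = fderiv ℝ (christoffelL G) y u v w := fun u v w => by
    have := hG.differentiableAt_christoffelL hy
    rw [fderiv_clm_apply (by fun_prop) (by fun_prop), fderiv_clm_apply (by fun_prop) (by fun_prop)]
    simp
  rw [curvature]
  simp only [hG.christoffel_eq hy, h, h']

/-- Compatibility of the connection with the metric, in components. -/
theorem fderiv_eq_christoffelL (hG : IsMetricOn G U) (hy : y ∈ U) (u v w : E) :
    fderiv ℝ G y u v w = G y (christoffelL G y u v) w + G y v (christoffelL G y u w) := by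
  rw [hG.symm y hy v, hG.apply_christoffelL hy, hG.apply_christoffelL hy,
    christoffelFirstL_apply, christoffelFirstL_apply, hG.fderiv_symm hy u w v,
    hG.fderiv_symm hy w u v, hG.fderiv_symm hy v u w, hG.fderiv_symm hy v w u]
  ring

end IsMetricOn

/-! The coordinate expressions depend only on the germ of the metric. -/

section Congr

variable {G G' K K' : E → E → E → ℝ}

theorem christoffelFirst_congr (h : G =ᶠ[nhds y] G') (u v w : E) :
    christoffelFirst G y u v w = christoffelFirst G' y u v w := by
  have h' : ∀ v w, fderiv ℝ (fun z => G z v w) y = fderiv ℝ (fun z => G' z v w) y := fun v w => by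
    apply Filter.EventuallyEq.fderiv_eq
    filter_upwards [h] with z hz
    rw [hz]
  simp only [christoffelFirst, h']

variable [FiniteDimensional ℝ E]

theorem christoffel_congr (h : G =ᶠ[nhds y] G') (u v : E) :
    christoffel G y u v = christoffel G' y u v := by
  simp only [christoffel, christoffelFirst_congr h, h.self_of_nhds]

theorem curvature_congr (h : G =ᶠ[nhds y] G') (u v w : E) :
    curvature G y u v w = curvature G' y u v w := by
  have h' : ∀ v w, fderiv ℝ (fun z => christoffel G z v w) y
      = fderiv ℝ (fun z => christoffel G' z v w) y := fun v w => by
    apply Filter.EventuallyEq.fderiv_eq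
    filter_upwards [eventually_eventually_nhds.2 h] with z hz using christoffel_congr hz v w
  simp only [curvature, h', christoffel_congr h]

theorem covariantDeriv_congr (h : G =ᶠ[nhds y] G') (hK : K =ᶠ[nhds y] K') (u v w : E) :
    covariantDeriv G K y u v w = covariantDeriv G' K' y u v w := by
  have h' : ∀ v w, fderiv ℝ (fun z => K z v w) y = fderiv ℝ (fun z => K' z v w) y := fun v w => by
    apply Filter.EventuallyEq.fderiv_eq
    filter_upwards [hK] with z hz
    rw [hz]
  simp only [covariantDeriv, h', christoffel_congr h, hK.self_of_nhds]

end Congr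

end Chart

/-! ### Products and cones in coordinates -/

theorem hasFDerivAt_apply₂ {E F₁ F₂ F₃ : Type*} [NormedAddCommGroup E] [NormedSpace ℝ E]
    [NormedAddCommGroup F₁] [NormedSpace ℝ F₁] [NormedAddCommGroup F₂] [NormedSpace ℝ F₂]
    [NormedAddCommGroup F₃] [NormedSpace ℝ F₃] {G : E → F₁ →L[ℝ] F₂ →L[ℝ] F₃} {y : E}
    (h : DifferentiableAt ℝ G y) (v : F₁) (w : F₂) :
    HasFDerivAt (fun z => G z v w) (((fderiv ℝ G y).flip v).flip w) y := by
  refine ((h.hasFDerivAt.clm_apply (hasFDerivAt_const v y)).clm_apply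
    (hasFDerivAt_const w y)).congr_fderiv ?_
  ext u
  simp

section ProductForm

variable {E₁ : Type*} [NormedAddCommGroup E₁] [NormedSpace ℝ E₁]
  {E₂ : Type*} [NormedAddCommGroup E₂] [NormedSpace ℝ E₂]

/-- The form `G₁ + G₂` on a product of charts. -/
def prodForm (G₁ : E₁ → E₁ →L[ℝ] E₁ →L[ℝ] ℝ) (G₂ : E₂ → E₂ →L[ℝ] E₂ →L[ℝ] ℝ)
    (y : E₁ × E₂) : E₁ × E₂ →L[ℝ] E₁ × E₂ →L[ℝ] ℝ :=
  pullbackForm (G₁ y.1) (ContinuousLinearMap.fst ℝ E₁ E₂)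
    + pullbackForm (G₂ y.2) (ContinuousLinearMap.snd ℝ E₁ E₂)

theorem prodForm_apply (G₁ : E₁ → E₁ →L[ℝ] E₁ →L[ℝ] ℝ) (G₂ : E₂ → E₂ →L[ℝ] E₂ →L[ℝ] ℝ)
    (y u v : E₁ × E₂) : prodForm G₁ G₂ y u v = G₁ y.1 u.1 v.1 + G₂ y.2 u.2 v.2 := rfl

/-- The form `f(r) K` on a product of an interval with a chart. -/
def radialForm (f : ℝ → ℝ) (K : E₁ → E₁ →L[ℝ] E₁ →L[ℝ] ℝ)
    (y : ℝ × E₁) : ℝ × E₁ →L[ℝ] ℝ × E₁ →L[ℝ] ℝ :=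
  f y.1 • pullbackForm (K y.2) (ContinuousLinearMap.snd ℝ ℝ E₁)

theorem radialForm_apply (f : ℝ → ℝ) (K : E₁ → E₁ →L[ℝ] E₁ →L[ℝ] ℝ) (y u v : ℝ × E₁) :
    radialForm f K y u v = f y.1 * K y.2 u.2 v.2 := rfl

/-- The form `dr² + r² G` on a product of an interval with a chart. -/
def coneForm (G : E₁ → E₁ →L[ℝ] E₁ →L[ℝ] ℝ)
    (y : ℝ × E₁) : ℝ × E₁ →L[ℝ] ℝ × E₁ →L[ℝ] ℝ :=
  pullbackForm (ContinuousLinearMap.mul ℝ ℝ) (ContinuousLinearMap.fst ℝ ℝ E₁)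
    + radialForm (fun r => r ^ 2) G y

theorem coneForm_apply (G : E₁ → E₁ →L[ℝ] E₁ →L[ℝ] ℝ) (y u v : ℝ × E₁) :
    coneForm G y u v = u.1 * v.1 + y.1 ^ 2 * G y.2 u.2 v.2 := rfl

variable {G₁ : E₁ → E₁ →L[ℝ] E₁ →L[ℝ] ℝ} {G₂ : E₂ → E₂ →L[ℝ] E₂ →L[ℝ] ℝ} {U₁ : Set E₁} {U₂ : Set E₂}

variable {y : E₁ × E₂}

namespace IsMetricOn

theorem fderiv_prod (h₁ : IsMetricOn G₁ U₁) (h₂ : IsMetricOn G₂ U₂) (hy₁ : y.1 ∈ U₁)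
    (hy₂ : y.2 ∈ U₂) (a b : ℝ) (u v w : E₁ × E₂) :
    fderiv ℝ (fun z : E₁ × E₂ => a * G₁ z.1 v.1 w.1 + b * G₂ z.2 v.2 w.2) y u
      = a * fderiv ℝ G₁ y.1 u.1 v.1 w.1 + b * fderiv ℝ G₂ y.2 u.2 v.2 w.2 := by
  have d₁ := ((hasFDerivAt_apply₂ (h₁.differentiableAt hy₁) v.1 w.1).comp y
    (hasFDerivAt_fst (𝕜 := ℝ))).const_mul a
  have d₂ := ((hasFDerivAt_apply₂ (h₂.differentiableAt hy₂) v.2 w.2).comp y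
    (hasFDerivAt_snd (𝕜 := ℝ))).const_mul b
  have := (d₁.add d₂).fderiv
  simp only [Function.comp_def] at this
  exact (DFunLike.congr_fun this u).trans (by simp)

variable [FiniteDimensional ℝ E₁] [FiniteDimensional ℝ E₂]

theorem prod (h₁ : IsMetricOn G₁ U₁) (h₂ : IsMetricOn G₂ U₂) :
    IsMetricOn (prodForm G₁ G₂) (U₁ ×ˢ U₂) where
  isOpen := h₁.isOpen.prod h₂.isOpen
  contDiffOn := by
    refine contDiffOn_clm_apply.2 fun u => contDiffOn_clm_apply.2 fun v => ?_
    simp only [prodForm_apply]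
    refine ContDiffOn.add ?_ ?_
    · exact ((h₁.contDiffOn.comp contDiff_fst.contDiffOn fun y hy => hy.1).clm_apply
        contDiffOn_const).clm_apply contDiffOn_const
    · exact ((h₂.contDiffOn.comp contDiff_snd.contDiffOn fun y hy => hy.2).clm_apply
        contDiffOn_const).clm_apply contDiffOn_const
  symm y hy u v := by
    rw [prodForm_apply, prodForm_apply, h₁.symm _ hy.1, h₂.symm _ hy.2]
  pos y hy v hv := by
    rw [prodForm_apply]
    have p₁ : 0 ≤ G₁ y.1 v.1 v.1 := by
      by_cases h : v.1 = 0
      · simp [h]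
      · exact (h₁.pos _ hy.1 _ h).le
    have p₂ : 0 ≤ G₂ y.2 v.2 v.2 := by
      by_cases h : v.2 = 0
      · simp [h]
      · exact (h₂.pos _ hy.2 _ h).le
    by_cases h : v.1 = 0
    · have h' : v.2 ≠ 0 := fun h' => hv (Prod.ext h h')
      exact add_pos_of_nonneg_of_pos p₁ (h₂.pos _ hy.2 _ h')
    · exact add_pos_of_pos_of_nonneg (h₁.pos _ hy.1 _ h) p₂

theorem cone (h₁ : IsMetricOn G₁ U₁) :
    IsMetricOn (coneForm G₁) (Set.Ioi 0 ×ˢ U₁) where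
  isOpen := isOpen_Ioi.prod h₁.isOpen
  contDiffOn := by
    refine contDiffOn_clm_apply.2 fun u => contDiffOn_clm_apply.2 fun v => ?_
    simp only [coneForm_apply]
    refine contDiffOn_const.add ((contDiff_fst.pow 2).contDiffOn.mul ?_)
    exact ((h₁.contDiffOn.comp contDiff_snd.contDiffOn fun y hy => hy.2).clm_apply
        contDiffOn_const).clm_apply contDiffOn_const
  symm y hy u v := by
    rw [coneForm_apply, coneForm_apply, h₁.symm _ hy.2, mul_comm u.1]
  pos y hy v hv := by
    have hr : 0 < y.1 := hy.1
    rw [coneForm_apply]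
    by_cases h : v.2 = 0
    · have h' : v.1 ≠ 0 := fun h' => hv (Prod.ext h' h)
      simpa [h] using mul_self_pos.2 h'
    · have := h₁.pos _ hy.2 _ h
      have := mul_self_nonneg v.1
      positivity

theorem christoffelL_prod (h₁ : IsMetricOn G₁ U₁) (h₂ : IsMetricOn G₂ U₂) (hy₁ : y.1 ∈ U₁)
    (hy₂ : y.2 ∈ U₂) (u v : E₁ × E₂) :
    christoffelL (prodForm G₁ G₂) y u v
      = (christoffelL G₁ y.1 u.1 v.1, christoffelL G₂ y.2 u.2 v.2) := by
  have h := h₁.prod h₂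
  have hy : y ∈ U₁ ×ˢ U₂ := ⟨hy₁, hy₂⟩
  refine h.christoffelL_eq_of_forall hy fun w => ?_
  have hD : ∀ u v w : E₁ × E₂, fderiv ℝ (prodForm G₁ G₂) y u v w
      = fderiv ℝ G₁ y.1 u.1 v.1 w.1 + fderiv ℝ G₂ y.2 u.2 v.2 w.2 := fun u v w => by
    rw [← IsMetricOn.fderiv_apply h hy]
    simpa [prodForm_apply] using h₁.fderiv_prod h₂ hy₁ hy₂ 1 1 u v w
  rw [prodForm_apply, h₁.apply_christoffelL hy₁, h₂.apply_christoffelL hy₂]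
  simp only [christoffelFirstL_apply, hD]
  ring

theorem curvature_prod (h₁ : IsMetricOn G₁ U₁) (h₂ : IsMetricOn G₂ U₂) (hy₁ : y.1 ∈ U₁)
    (hy₂ : y.2 ∈ U₂) (u v w : E₁ × E₂) :
    curvature (fun y u v => prodForm G₁ G₂ y u v) y u v w
      = (curvature (fun y u v => G₁ y u v) y.1 u.1 v.1 w.1,
          curvature (fun y u v => G₂ y u v) y.2 u.2 v.2 w.2) := by
  have h := h₁.prod h₂
  have hy : y ∈ U₁ ×ˢ U₂ := ⟨hy₁, hy₂⟩
  have hD : ∀ u v w : E₁ × E₂, fderiv ℝ (christoffelL (prodForm G₁ G₂)) y u v w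
      = (fderiv ℝ (christoffelL G₁) y.1 u.1 v.1 w.1,
          fderiv ℝ (christoffelL G₂) y.2 u.2 v.2 w.2) := fun u v w => by
    have e := (hasFDerivAt_apply₂ (h.differentiableAt_christoffelL hy) v w).fderiv
    have e' : fderiv ℝ (fun z => christoffelL (prodForm G₁ G₂) z v w) y
        = fderiv ℝ (fun z : E₁ × E₂ =>
          (christoffelL G₁ z.1 v.1 w.1, christoffelL G₂ z.2 v.2 w.2)) y := by
      apply Filter.EventuallyEq.fderiv_eq
      filter_upwards [h.isOpen.mem_nhds hy] with z hz using h₁.christoffelL_prod h₂ hz.1 hz.2 v w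
    have d₁ := (hasFDerivAt_apply₂ (h₁.differentiableAt_christoffelL hy₁) v.1 w.1).comp y
      (hasFDerivAt_fst (𝕜 := ℝ))
    have d₂ := (hasFDerivAt_apply₂ (h₂.differentiableAt_christoffelL hy₂) v.2 w.2).comp y
      (hasFDerivAt_snd (𝕜 := ℝ))
    have d := (d₁.prodMk d₂).fderiv
    simp only [Function.comp_def] at d
    have := DFunLike.congr_fun (e.symm.trans (e'.trans d)) u
    simpa using this
  rw [h.curvature_eq hy, h₁.curvature_eq hy₁, h₂.curvature_eq hy₂]
  simp only [hD, h₁.christoffelL_prod h₂ hy₁ hy₂, Prod.mk_add_mk, Prod.mk_sub_mk]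

/-- Each factor of a product metric is parallel. -/
theorem covariantDeriv_prod (h₁ : IsMetricOn G₁ U₁) (h₂ : IsMetricOn G₂ U₂) (hy₁ : y.1 ∈ U₁)
    (hy₂ : y.2 ∈ U₂) (a b : ℝ) (u v w : E₁ × E₂) :
    covariantDeriv (fun y u v => prodForm G₁ G₂ y u v)
      (fun y u v => a * G₁ y.1 u.1 v.1 + b * G₂ y.2 u.2 v.2) y u v w = 0 := by
  have h := h₁.prod h₂
  have hy : y ∈ U₁ ×ˢ U₂ := ⟨hy₁, hy₂⟩
  rw [covariantDeriv, h₁.fderiv_prod h₂ hy₁ hy₂]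
  simp only [h.christoffel_eq hy, h₁.christoffelL_prod h₂ hy₁ hy₂, h₁.fderiv_eq_christoffelL hy₁,
    h₂.fderiv_eq_christoffelL hy₂]
  ring

end IsMetricOn

end ProductForm

section ConeForm

variable {E : Type*} [NormedAddCommGroup E] [NormedSpace ℝ E]
  {G K : E → E →L[ℝ] E →L[ℝ] ℝ} {U : Set E} {y : ℝ × E}

theorem fderiv_radial {f : ℝ → ℝ} {f' : ℝ} (hf : HasDerivAt f f' y.1)
    (hK : DifferentiableAt ℝ K y.2) (u v w : E) (t : ℝ) :
    fderiv ℝ (fun z : ℝ × E => f z.1 * K z.2 v w) y (t, u)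
      = t * f' * K y.2 v w + f y.1 * fderiv ℝ K y.2 u v w := by
  have d₁ := hf.hasFDerivAt.comp y (hasFDerivAt_fst (𝕜 := ℝ))
  have d₂ := (hasFDerivAt_apply₂ hK v w).comp y (hasFDerivAt_snd (𝕜 := ℝ))
  have := (d₁.mul d₂).fderiv
  simp only [Function.comp_def] at this
  refine (DFunLike.congr_fun this (t, u)).trans ?_
  simp
  ring

variable [FiniteDimensional ℝ E]

namespace IsMetricOn

theorem christoffelL_cone (hG : IsMetricOn G U) (hr : 0 < y.1) (hy' : y.2 ∈ U) (u v : ℝ × E) :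
    christoffelL (coneForm G) y u v
      = (-(y.1 * G y.2 u.2 v.2),
          christoffelL G y.2 u.2 v.2 + y.1⁻¹ • (u.1 • v.2 + v.1 • u.2)) := by
  have h := hG.cone
  have hy : y ∈ Set.Ioi 0 ×ˢ U := ⟨hr, hy'⟩
  refine h.christoffelL_eq_of_forall hy fun w => ?_
  have hD : ∀ u v w : ℝ × E, fderiv ℝ (coneForm G) y u v w
      = u.1 * (2 * y.1) * G y.2 v.2 w.2 + y.1 ^ 2 * fderiv ℝ G y.2 u.2 v.2 w.2 := fun u v w => by
    rw [← IsMetricOn.fderiv_apply h hy]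
    simp only [coneForm_apply, fderiv_const_add]
    refine fderiv_radial (f := fun r => r ^ 2) ?_ (hG.differentiableAt hy') _ _ _ _
    simpa using hasDerivAt_pow 2 y.1
  have hr' : y.1 ≠ 0 := hr.ne'
  rw [coneForm_apply]
  simp only [map_add, map_smul, _root_.add_apply, _root_.smul_apply, smul_eq_mul,
    hG.apply_christoffelL hy']
  simp only [christoffelFirstL_apply, hD]
  field_simp
  ring

/-- The Gauss equation of the cone. -/
theorem curvature_cone (hG : IsMetricOn G U) (hr : 0 < y.1) (hy' : y.2 ∈ U) (u v w : ℝ × E) :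
    curvature (fun y u v => coneForm G y u v) y u v w
      = (0, curvature (fun y u v => G y u v) y.2 u.2 v.2 w.2
          - G y.2 v.2 w.2 • u.2 + G y.2 u.2 w.2 • v.2) := by
  have h := hG.cone
  have hy : y ∈ Set.Ioi 0 ×ˢ U := ⟨hr, hy'⟩
  have hr' : y.1 ≠ 0 := hr.ne'
  have hD : ∀ u v w : ℝ × E, fderiv ℝ (christoffelL (coneForm G)) y u v w
      = (-(u.1 * G y.2 v.2 w.2 + y.1 * fderiv ℝ G y.2 u.2 v.2 w.2),
          fderiv ℝ (christoffelL G) y.2 u.2 v.2 w.2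
            - (u.1 * (y.1 ^ 2)⁻¹) • (v.1 • w.2 + w.1 • v.2)) := fun u v w => by
    have e := (hasFDerivAt_apply₂ (h.differentiableAt_christoffelL hy) v w).fderiv
    have e' : fderiv ℝ (fun z => christoffelL (coneForm G) z v w) y
        = fderiv ℝ (fun z : ℝ × E => (-(z.1 * G z.2 v.2 w.2),
          christoffelL G z.2 v.2 w.2 + z.1⁻¹ • (v.1 • w.2 + w.1 • v.2))) y := by
      apply Filter.EventuallyEq.fderiv_eq
      filter_upwards [h.isOpen.mem_nhds hy] with z hz using hG.christoffelL_cone hz.1 hz.2 v w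
    have d₀ := hasFDerivAt_fst (𝕜 := ℝ) (p := y)
    have d₁ := (d₀.mul ((hasFDerivAt_apply₂ (hG.differentiableAt hy') v.2 w.2).comp y
      (hasFDerivAt_snd (𝕜 := ℝ)))).neg
    have d₂ := (hasFDerivAt_apply₂ (hG.differentiableAt_christoffelL hy') v.2 w.2).comp y
      (hasFDerivAt_snd (𝕜 := ℝ))
    have d₃ := ((hasDerivAt_inv hr').hasFDerivAt.comp y d₀).smul_const (v.1 • w.2 + w.1 • v.2)
    have d := (d₁.prodMk (d₂.add d₃)).fderiv
    have := DFunLike.congr_fun (e.symm.trans (e'.trans d)) u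
    refine Eq.trans ?_ (this.trans ?_)
    · simp
    · ext
      · simp
        ring
      · simp
        module
  rw [h.curvature_eq hy, hG.curvature_eq hy']
  simp only [hD, hG.christoffelL_cone hr hy']
  ext
  · simp only [Prod.fst_add, Prod.fst_sub, map_add, map_smul, smul_eq_mul,
      hG.fderiv_eq_christoffelL hy', hG.christoffelL_symm hy' v.2 u.2,
      hG.symm _ hy' (christoffelL G y.2 u.2 v.2), hG.symm _ hy' v.2 u.2]
    field_simp
    ring
  · simp only [Prod.snd_add, Prod.snd_sub, map_add, map_smul, hG.christoffelL_symm hy' v.2 u.2]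
    match_scalars <;> field_simp <;> ring

theorem covariantDeriv_cone (hG : IsMetricOn G U) (hr : 0 < y.1) (hy' : y.2 ∈ U)
    (hK : DifferentiableAt ℝ K y.2) {f : ℝ → ℝ} {f' : ℝ} (hf : HasDerivAt f f' y.1)
    (u v w : ℝ × E) :
    covariantDeriv (fun y u v => coneForm G y u v) (fun y u v => radialForm f K y u v) y u v w
      = u.1 * (f' - 2 * f y.1 / y.1) * K y.2 v.2 w.2
        + f y.1 * covariantDeriv (fun y u v => G y u v) (fun y u v => K y u v) y.2 u.2 v.2 w.2
        - f y.1 / y.1 * (v.1 * K y.2 u.2 w.2 + w.1 * K y.2 v.2 u.2) := by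
  have h := hG.cone
  have hy : y ∈ Set.Ioi 0 ×ˢ U := ⟨hr, hy'⟩
  have hr' : y.1 ≠ 0 := hr.ne'
  have hD : fderiv ℝ (fun z => K z v.2 w.2) y.2 u.2 = fderiv ℝ K y.2 u.2 v.2 w.2 :=
    DFunLike.congr_fun (hasFDerivAt_apply₂ hK v.2 w.2).fderiv u.2
  simp only [covariantDeriv, radialForm_apply, h.christoffel_eq hy, hG.christoffel_eq hy',
    hG.christoffelL_cone hr hy']
  rw [fderiv_radial hf hK, hD]
  simp only [map_add, map_smul, _root_.add_apply, _root_.smul_apply, smul_eq_mul]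
  field_simp
  ring

end IsMetricOn

end ConeForm

/-! ### Tensor fields in charts -/

section InChart

variable {E : Type*} [NormedAddCommGroup E] [NormedSpace ℝ E]
  {H : Type*} [TopologicalSpace H] {I : ModelWithCorners ℝ E H}
  {M : Type*} [TopologicalSpace M] [ChartedSpace H M]

variable (I) in
/-- The derivative of the inverse of the preferred chart at `p`, as an endomorphism of the model
space: the tangent spaces of `M` are copies of the model space. -/
def chartDeriv (p : M) (y : E) : E →L[ℝ] E :=
  mfderivWithin 𝓘(ℝ, E) I (extChartAt I p).symm (Set.range I) y

/-- The components of a tensor field in the preferred chart at `p`, as a bundled bilinear form. -/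
def inChartL (T : TensorField I M) (p : M) (y : E) : E →L[ℝ] E →L[ℝ] ℝ :=
  pullbackForm (E := E) (F := E) (T ((extChartAt I p).symm y)) (chartDeriv I p y)

theorem inChart_eq [FiniteDimensional ℝ E] (T : TensorField I M) (p : M) :
    inChart T p = fun y u v => inChartL T p y u v := rfl

/-- The value of a tensor field at `p`, as a bundled form on the model space. -/
def formAtL (T : TensorField I M) (p : M) : E →L[ℝ] E →L[ℝ] ℝ := T p

variable [IsManifold I ∞ M]

theorem inChartL_self (T : TensorField I M) (p : M) :
    inChartL T p (extChartAt I p p) = formAtL T p := by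
  ext u v
  have h := mfderivWithin_range_extChartAt_symm (I := I) (x := p)
  have h' : (extChartAt I p).symm (extChartAt I p p) = p := extChartAt_to_inv p
  change T _ (mfderivWithin _ _ _ _ _ u) (mfderivWithin _ _ _ _ _ v) = T p u v
  rw [h]
  change T ((extChartAt I p).symm (extChartAt I p p)) u v = T p u v
  rw [h']

theorem inCoordinates_eq_inChartL (T : TensorField I M) (p : M) {x : M}
    (hx : x ∈ (chartAt H p).source) :
    ContinuousLinearMap.inCoordinates E (TangentSpace I : M → Type _) (E →L[ℝ] ℝ)
      (fun x => TangentSpace I x →L[ℝ] ℝ) p x p x (T x) = inChartL T p (extChartAt I p x) := by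
  ext u v
  have h' : (extChartAt I p).symm (extChartAt I p x) = x :=
    (extChartAt I p).left_inv (by simpa using hx)
  have hm := TangentBundle.symmL_trivializationAt (I := I) hx
  rw [inCoordinates_apply_eq₂ (E₃ := fun _ : M => ℝ) (F₃ := ℝ) (by simpa using hx)
    (by simpa using hx) (Set.mem_univ _)]
  have e1 : ∀ u : E, (trivializationAt E (TangentSpace I) p).symm x u
      = (mfderivWithin 𝓘(ℝ, E) I (extChartAt I p).symm (Set.range I) (extChartAt I p x) u : E) :=
    fun u => ((trivializationAt E (TangentSpace I) p).symmL_apply (R := ℝ) (by simpa using hx)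
      u).symm.trans (DFunLike.congr_fun hm u)
  have e2 : ∀ x', x' = x → ∀ a b : E, T x' a b = T x a b := by
    rintro _ rfl _ _
    rfl
  refine Eq.trans ?_ (e2 _ h' (mfderivWithin 𝓘(ℝ, E) I (extChartAt I p).symm (Set.range I)
    (extChartAt I p x) u) (mfderivWithin 𝓘(ℝ, E) I (extChartAt I p).symm (Set.range I)
    (extChartAt I p x) v)).symm
  rw [e1, e1]
  simp

/-- A 2-tensor field is smooth exactly if its components in the preferred charts are. -/
theorem contMDiff_iff_contDiffOn_inChartL [I.Boundaryless] (T : TensorField I M) :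
    ContMDiff I (I.prod 𝓘(ℝ, E →L[ℝ] E →L[ℝ] ℝ)) ∞
      (fun x => TotalSpace.mk' (E →L[ℝ] E →L[ℝ] ℝ)
        (E := fun x : M => TangentSpace I x →L[ℝ] TangentSpace I x →L[ℝ] ℝ) x (T x))
      ↔ ∀ p, ContDiffOn ℝ ∞ (inChartL T p) (extChartAt I p).target := by
  have key : ∀ p : M, ContMDiffOn I (I.prod 𝓘(ℝ, E →L[ℝ] E →L[ℝ] ℝ)) ∞
      (fun x => TotalSpace.mk' (E →L[ℝ] E →L[ℝ] ℝ)
        (E := fun x : M => TangentSpace I x →L[ℝ] TangentSpace I x →L[ℝ] ℝ) x (T x))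
      (chartAt H p).source
      ↔ ContDiffOn ℝ ∞ (inChartL T p) (extChartAt I p).target := by
    intro p
    rw [(trivializationAt (E →L[ℝ] E →L[ℝ] ℝ)
      (fun x : M => TangentSpace I x →L[ℝ] TangentSpace I x →L[ℝ] ℝ) p).contMDiffOn_section_iff
      (chartAt H p).open_source (by simp)]
    have e : ∀ x ∈ (chartAt H p).source,
        ((trivializationAt (E →L[ℝ] E →L[ℝ] ℝ)
          (fun x : M => TangentSpace I x →L[ℝ] TangentSpace I x →L[ℝ] ℝ) p) ⟨x, T x⟩).2
        = inChartL T p (extChartAt I p x) := fun x hx =>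
      inCoordinates_eq_inChartL T p hx
    rw [contMDiffOn_congr e]
    constructor
    · intro h
      have := h.comp (contMDiffOn_extChartAt_symm p) (s := (extChartAt I p).target)
        fun y hy => by simpa using (extChartAt I p).map_target hy
      rw [← contMDiffOn_iff_contDiffOn]
      refine this.congr fun y hy => ?_
      simp only [Function.comp_apply, (extChartAt I p).right_inv hy]
    · intro h
      rw [← contMDiffOn_iff_contDiffOn] at h
      refine h.comp contMDiffOn_extChartAt fun x hx => ?_
      exact (extChartAt I p).map_source (by simpa using hx)
  refine ⟨fun h p => (key p).1 h.contMDiffOn, fun h p => ?_⟩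
  exact ((key p).2 (h p)).contMDiffAt ((chartAt H p).open_source.mem_nhds (mem_chart_source H p))

/-- A tensor field whose components in every preferred chart are a smooth Riemannian metric. -/
def IsMetric (g : TensorField I M) : Prop :=
  ∀ p, IsMetricOn (inChartL g p) (extChartAt I p).target

theorem isMetric_of_contMDiff [I.Boundaryless] {g : TensorField I M}
    (hg : ContMDiff I (I.prod 𝓘(ℝ, E →L[ℝ] E →L[ℝ] ℝ)) ∞
      (fun x => TotalSpace.mk' (E →L[ℝ] E →L[ℝ] ℝ)
        (E := fun x : M => TangentSpace I x →L[ℝ] TangentSpace I x →L[ℝ] ℝ) x (g x)))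
    (hs : ∀ (x : M) (u v : TangentSpace I x), g x u v = g x v u)
    (hp : ∀ (x : M) (v : TangentSpace I x), v ≠ 0 → 0 < g x v v) : IsMetric g := by
  intro p
  refine ⟨isOpen_extChartAt_target p, (contMDiff_iff_contDiffOn_inChartL g).1 hg p, ?_, ?_⟩
  · intro y _ u v
    exact hs ((extChartAt I p).symm y) _ _
  · intro y hy v hv
    refine hp ((extChartAt I p).symm y) _ fun h => hv ?_
    exact (isInvertible_mfderivWithin_extChartAt_symm (I := I) hy).injective
      (h.trans (map_zero _).symm)

end InChart

/-! ### Charts of products and cones -/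

section ProductChart

variable {E₁ : Type*} [NormedAddCommGroup E₁] [NormedSpace ℝ E₁]
  {H₁ : Type*} [TopologicalSpace H₁] {I₁ : ModelWithCorners ℝ E₁ H₁}
  {M₁ : Type*} [TopologicalSpace M₁] [ChartedSpace H₁ M₁] [IsManifold I₁ ∞ M₁]
  {E₂ : Type*} [NormedAddCommGroup E₂] [NormedSpace ℝ E₂]
  {H₂ : Type*} [TopologicalSpace H₂] {I₂ : ModelWithCorners ℝ E₂ H₂}
  {M₂ : Type*} [TopologicalSpace M₂] [ChartedSpace H₂ M₂] [IsManifold I₂ ∞ M₂]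

theorem chartDeriv_prod (p : M₁ × M₂) {y : E₁ × E₂}
    (hy₁ : y.1 ∈ (extChartAt I₁ p.1).target) (hy₂ : y.2 ∈ (extChartAt I₂ p.2).target)
    (v : E₁ × E₂) :
    chartDeriv (I₁.prod I₂) p y v = (chartDeriv I₁ p.1 y.1 v.1, chartDeriv I₂ p.2 y.2 v.2) := by
  have h := mfderivWithin_prodMap (p := y) (mdifferentiableWithinAt_extChartAt_symm hy₁)
    (mdifferentiableWithinAt_extChartAt_symm hy₂)
    (I₁.uniqueDiffOn.uniqueMDiffOn _ (extChartAt_target_subset_range p.1 hy₁))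
    (I₂.uniqueDiffOn.uniqueMDiffOn _ (extChartAt_target_subset_range p.2 hy₂))
  rw [← modelWithCornersSelf_prod, chartedSpaceSelf_prod] at h
  have hr : Set.range (I₁.prod I₂) = Set.range I₁ ×ˢ Set.range I₂ := I₁.range_prod
  rw [chartDeriv, extChartAt_prod, hr]
  exact DFunLike.congr_fun h v

theorem inChartL_productMetric (γ₁ : TensorField I₁ M₁) (γ₂ : TensorField I₂ M₂) (p : M₁ × M₂)
    {y : E₁ × E₂} (hy : y ∈ (extChartAt (I₁.prod I₂) p).target) :
    inChartL (productMetric γ₁ γ₂) p y = prodForm (inChartL γ₁ p.1) (inChartL γ₂ p.2) y := by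
  rw [extChartAt_prod] at hy
  refine ContinuousLinearMap.ext fun u => ContinuousLinearMap.ext fun v => ?_
  have hm := chartDeriv_prod (I₁ := I₁) (I₂ := I₂) p hy.1 hy.2
  refine (productMetric_apply γ₁ γ₂ _ (chartDeriv _ p y u) (chartDeriv _ p y v)).trans ?_
  rw [hm, hm]
  rfl

end ProductChart

section ConeChart

variable {E : Type*} [NormedAddCommGroup E] [NormedSpace ℝ E]
  {H : Type*} [TopologicalSpace H] {I : ModelWithCorners ℝ E H}
  {M : Type*} [TopologicalSpace M] [ChartedSpace H M]

theorem extChartAt_posReals_target (r : posReals) :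
    (extChartAt 𝓘(ℝ, ℝ) r).target = Set.Ioi 0 := by
  have hs : (extChartAt 𝓘(ℝ, ℝ) r).source = Set.univ := by
    rw [extChartAt_source]
    change ((chartAt ℝ (r : ℝ)).subtypeRestr ⟨r⟩).source = _
    rw [OpenPartialHomeomorph.subtypeRestr_source]
    exact Set.eq_univ_of_forall fun _ => Set.mem_univ _
  rw [← PartialEquiv.image_source_eq_target, hs, Set.image_univ]
  exact Subtype.range_coe

theorem coe_extChartAt_posReals_symm (r : posReals) {t : ℝ} (ht : 0 < t) :
    ((extChartAt 𝓘(ℝ, ℝ) r).symm t : ℝ) = t :=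
  (extChartAt 𝓘(ℝ, ℝ) r).right_inv (by rw [extChartAt_posReals_target]; exact ht)

theorem chartDeriv_posReals (r : posReals) {t : ℝ} (ht : 0 < t) (v : ℝ) :
    chartDeriv 𝓘(ℝ, ℝ) r t v = v :=
  -- All points of the half-line have the same preferred chart.
  DFunLike.congr_fun
    (mfderivWithin_range_extChartAt_symm (I := 𝓘(ℝ, ℝ)) (x := (⟨t, ht⟩ : posReals))) v

theorem extChartAt_cone_target (p : Cone M) :
    (extChartAt (𝓘(ℝ, ℝ).prod I) p).target = Set.Ioi 0 ×ˢ (extChartAt I p.2).target := by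
  rw [extChartAt_prod, PartialEquiv.prod_target, extChartAt_posReals_target]

/-- The tensor field `f(r) k` on the cone over `M`, for a tensor field `k` on `M`. -/
def radialTensor (f : ℝ → ℝ) (k : TensorField I M) : TensorField (𝓘(ℝ, ℝ).prod I) (Cone M) :=
  fun x => f x.1 •
    pullbackForm (E := ℝ × E) (F := E) (k x.2) (ContinuousLinearMap.snd ℝ ℝ E)

theorem radialTensor_apply (f : ℝ → ℝ) (k : TensorField I M) (x : Cone M) (u v : ℝ × E) :
    radialTensor f k x u v = f x.1 * k x.2 u.2 v.2 := rfl

variable [IsManifold I ∞ M]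

theorem inChartL_radialTensor (f : ℝ → ℝ) (k : TensorField I M) (p : Cone M)
    {y : ℝ × E} (hy : y ∈ (extChartAt (𝓘(ℝ, ℝ).prod I) p).target) :
    inChartL (radialTensor f k) p y = radialForm f (inChartL k p.2) y := by
  rw [extChartAt_cone_target] at hy
  refine ContinuousLinearMap.ext fun u => ContinuousLinearMap.ext fun v => ?_
  have hm := chartDeriv_prod (I₁ := 𝓘(ℝ, ℝ)) (I₂ := I) p (y := y)
    (by rw [extChartAt_posReals_target]; exact hy.1) hy.2
  have hs : (((extChartAt (𝓘(ℝ, ℝ).prod I) p).symm y).1 : ℝ) = y.1 :=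
    coe_extChartAt_posReals_symm p.1 hy.1
  refine (radialTensor_apply f k _ (chartDeriv _ p y u) (chartDeriv _ p y v)).trans ?_
  rw [hm, hm, hs]
  rfl

theorem inChartL_coneMetric (γ : TensorField I M) (p : Cone M)
    {y : ℝ × E} (hy : y ∈ (extChartAt (𝓘(ℝ, ℝ).prod I) p).target) :
    inChartL (coneMetric γ) p y = coneForm (inChartL γ p.2) y := by
  rw [extChartAt_cone_target] at hy
  refine ContinuousLinearMap.ext fun u => ContinuousLinearMap.ext fun v => ?_
  have hm := chartDeriv_prod (I₁ := 𝓘(ℝ, ℝ)) (I₂ := I) p (y := y)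
    (by rw [extChartAt_posReals_target]; exact hy.1) hy.2
  have hs : (((extChartAt (𝓘(ℝ, ℝ).prod I) p).symm y).1 : ℝ) = y.1 :=
    coe_extChartAt_posReals_symm p.1 hy.1
  have ht := chartDeriv_posReals p.1 (t := y.1) hy.1
  refine (coneMetric_apply γ _ (chartDeriv _ p y u) (chartDeriv _ p y v)).trans ?_
  rw [hm, hm, hs]
  simp only [ht]
  rfl

end ConeChart

/-! ### Curvature and covariant derivatives in orthonormal frames -/

theorem IsMetricOn.congr {E : Type*} [NormedAddCommGroup E] [NormedSpace ℝ E]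
    {G G' : E → E →L[ℝ] E →L[ℝ] ℝ} {U : Set E} (h : IsMetricOn G U)
    (hG : ∀ y ∈ U, G' y = G y) : IsMetricOn G' U where
  isOpen := h.isOpen
  contDiffOn := h.contDiffOn.congr hG
  symm y hy := by rw [hG y hy]; exact h.symm y hy
  pos y hy := by rw [hG y hy]; exact h.pos y hy

section LinearMap

variable {E : Type*} [AddCommGroup E] [Module ℝ E]

theorem isLinearMap_sum {ι : Type*} {s : Finset ι} {f : ι → E → ℝ}
    (h : ∀ i, IsLinearMap ℝ (f i)) : IsLinearMap ℝ fun u => ∑ i ∈ s, f i u where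
  map_add u v := by simp only [(h _).map_add, Finset.sum_add_distrib]
  map_smul c u := by simp only [(h _).map_smul, Finset.smul_sum]

theorem isLinearMap_mul_const {f : E → ℝ} (h : IsLinearMap ℝ f) (c : ℝ) :
    IsLinearMap ℝ fun u => f u * c where
  map_add u v := by simp only [h.map_add, add_mul]
  map_smul a u := by simp only [h.map_smul, smul_eq_mul, mul_assoc]

theorem isLinearMap_const_mul {f : E → ℝ} (h : IsLinearMap ℝ f) (c : ℝ) :
    IsLinearMap ℝ fun u => c * f u where
  map_add u v := by simp only [h.map_add, mul_add]
  map_smul a u := by simp only [h.map_smul, smul_eq_mul, mul_left_comm]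

end LinearMap

section Geometry

variable {E : Type*} [NormedAddCommGroup E] [NormedSpace ℝ E]
  {H : Type*} [TopologicalSpace H] {I : ModelWithCorners ℝ E H}
  {M : Type*} [TopologicalSpace M] [ChartedSpace H M]

theorem inChart_eventuallyEq [FiniteDimensional ℝ E] [I.Boundaryless] {T : TensorField I M}
    {p : M} {K : E → E →L[ℝ] E →L[ℝ] ℝ}
    (h : ∀ y ∈ (extChartAt I p).target, inChartL T p y = K y) :
    inChart T p =ᶠ[nhds (extChartAt I p p)] fun y u v => K y u v := by
  filter_upwards [extChartAt_target_mem_nhds p] with y hy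
  simp only [inChart_eq, h y hy]

variable [IsManifold I ∞ M] {g : TensorField I M}

namespace IsMetric

theorem symm (hg : IsMetric g) (p : M) (u v : E) : formAtL g p u v = formAtL g p v u := by
  rw [← inChartL_self]
  exact (hg p).symm _ (mem_extChartAt_target p) u v

variable [FiniteDimensional ℝ E]

theorem exists_frame (hg : IsMetric g) (p : M) :
    ∃ e : Fin (Module.finrank ℝ E) → E, IsFrame (formAtL g p) e := by
  rw [← inChartL_self]
  exact (hg p).exists_frame (mem_extChartAt_target p)

theorem riemann_eq (hg : IsMetric g) (p : M) (u v w z : E) :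
    let Γ := christoffelL (inChartL g p)
    let y := extChartAt I p p
    riemann g p u v w z = formAtL g p (fderiv ℝ Γ y u v z - fderiv ℝ Γ y v u z
      + Γ y u (Γ y v z) - Γ y v (Γ y u z)) w := by
  intro Γ y
  rw [← (hg p).curvature_eq (mem_extChartAt_target p)]
  rfl

theorem riemann_linear₁ (hg : IsMetric g) (p : M) (v w z : E) :
    IsLinearMap ℝ fun u => riemann g p u v w z := by
  constructor <;> intros <;> simp [hg.riemann_eq] <;> ring

theorem riemann_linear₂ (hg : IsMetric g) (p : M) (u w z : E) :
    IsLinearMap ℝ fun v => riemann g p u v w z := by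
  constructor <;> intros <;> simp [hg.riemann_eq] <;> ring

theorem riemann_linear₃ (hg : IsMetric g) (p : M) (u v z : E) :
    IsLinearMap ℝ fun w => riemann g p u v w z := by
  constructor <;> intros <;> simp [hg.riemann_eq] <;> ring

theorem riemann_linear₄ (hg : IsMetric g) (p : M) (u v w : E) :
    IsLinearMap ℝ fun z => riemann g p u v w z := by
  constructor <;> intros <;> simp [hg.riemann_eq] <;> ring

end IsMetric

variable [FiniteDimensional ℝ E] {ι : Type*} [Fintype ι] {p : M} {e : ι → E}

theorem contract_formAt_eq (he : IsFrame (formAtL g p) e) {V : Type*} [AddCommGroup V]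
    [Module ℝ V] (F : E → E → V)
    (h₁ : ∀ v, IsLinearMap ℝ fun u => F u v) (h₂ : ∀ u, IsLinearMap ℝ (F u)) :
    contract (formAt g p) F = ∑ i, F (e i) (e i) :=
  he.contract_eq F h₁ h₂

theorem ricci_eq_sum (hg : IsMetric g) (he : IsFrame (formAtL g p) e) (v z : E) :
    ricci g p v z = ∑ i, riemann g p (e i) v (e i) z :=
  contract_formAt_eq he _ (fun w => hg.riemann_linear₁ p v w z)
    fun u => hg.riemann_linear₃ p u v z

theorem rmQuadratic_eq_sum (hg : IsMetric g) (he : IsFrame (formAtL g p) e)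
    (h : TensorField I M) :
    rmQuadratic g h p = ∑ i, ∑ j, ∑ k, ∑ l, riemann g p (e i) (e j) (e k) (e l)
      * formAtL h p (e i) (e k) * formAtL h p (e j) (e l) := by
  have h' : ∀ u, IsLinearMap ℝ (formAtL h p u) := fun u => (formAtL h p u).toLinearMap.isLinear
  have h'' : ∀ v, IsLinearMap ℝ fun u => formAtL h p u v := fun v =>
    ((formAtL h p).flip v).toLinearMap.isLinear
  have hf : formAt h p = fun u v => formAtL h p u v := rfl
  have l₄ : ∀ i i' j j' k k', contract (formAt g p) (fun l l' =>
      riemann g p i j k l * formAtL h p i' k' * formAtL h p j' l')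
      = ∑ l, riemann g p i j k (e l) * formAtL h p i' k' * formAtL h p j' (e l) :=
    fun i i' j j' k k' => contract_formAt_eq he _
      (fun _ => isLinearMap_mul_const (isLinearMap_mul_const (hg.riemann_linear₄ p i j k) _) _)
      fun _ => isLinearMap_const_mul (h' _) _
  have l₃ : ∀ i i' j j', contract (formAt g p) (fun k k' => ∑ l,
      riemann g p i j k (e l) * formAtL h p i' k' * formAtL h p j' (e l))
      = ∑ k, ∑ l, riemann g p i j (e k) (e l) * formAtL h p i' (e k) * formAtL h p j' (e l) :=
    fun i i' j j' => contract_formAt_eq he _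
      (fun _ => isLinearMap_sum fun _ => isLinearMap_mul_const (isLinearMap_mul_const
        (hg.riemann_linear₃ p i j _) _) _)
      fun _ => isLinearMap_sum fun _ => isLinearMap_mul_const (isLinearMap_const_mul (h' _) _) _
  have l₂ : ∀ i i', contract (formAt g p) (fun j j' => ∑ k, ∑ l,
      riemann g p i j (e k) (e l) * formAtL h p i' (e k) * formAtL h p j' (e l))
      = ∑ j, ∑ k, ∑ l, riemann g p i (e j) (e k) (e l) * formAtL h p i' (e k)
        * formAtL h p (e j) (e l) :=
    fun i i' => contract_formAt_eq he _
      (fun _ => isLinearMap_sum fun _ => isLinearMap_sum fun _ => isLinearMap_mul_const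
        (isLinearMap_mul_const (hg.riemann_linear₂ p i _ _) _) _)
      fun _ => isLinearMap_sum fun _ => isLinearMap_sum fun _ => isLinearMap_const_mul (h'' _) _
  simp only [rmQuadratic, hf, l₄, l₃, l₂]
  exact contract_formAt_eq he _
    (fun _ => isLinearMap_sum fun _ => isLinearMap_sum fun _ => isLinearMap_sum fun _ =>
      isLinearMap_mul_const (isLinearMap_mul_const (hg.riemann_linear₁ p _ _ _) _) _)
    fun _ => isLinearMap_sum fun _ => isLinearMap_sum fun _ => isLinearMap_sum fun _ =>
      isLinearMap_mul_const (isLinearMap_const_mul (h'' _) _) _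

variable {h : TensorField I M}

theorem nabla_eq (hg : IsMetric g) (hh : DifferentiableAt ℝ (inChartL h p) (extChartAt I p p))
    (u v w : E) :
    let Γ := christoffelL (inChartL g p)
    let y := extChartAt I p p
    nabla g h p u v w = fderiv ℝ (inChartL h p) y u v w
      - formAtL h p (Γ y u v) w - formAtL h p v (Γ y u w) := by
  intro Γ y
  have hD : fderiv ℝ (fun z => inChartL h p z v w) y u = fderiv ℝ (inChartL h p) y u v w :=
    DFunLike.congr_fun (hasFDerivAt_apply₂ hh v w).fderiv u
  rw [nabla, covariantDeriv]
  simp only [inChart_eq, (hg p).christoffel_eq (mem_extChartAt_target p), inChartL_self]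
  rw [hD]

theorem nabla_linear (hg : IsMetric g)
    (hh : DifferentiableAt ℝ (inChartL h p) (extChartAt I p p)) :
    (∀ v w, IsLinearMap ℝ fun u => nabla g h p u v w) ∧
    (∀ u w, IsLinearMap ℝ fun v => nabla g h p u v w) ∧
    ∀ u v, IsLinearMap ℝ fun w => nabla g h p u v w := by
  refine ⟨fun _ _ => ?_, fun _ _ => ?_, fun _ _ => ?_⟩ <;>
    constructor <;> intros <;> simp [nabla_eq hg hh] <;> ring

theorem divergence_eq_sum (hg : IsMetric g) (he : IsFrame (formAtL g p) e)
    (hh : DifferentiableAt ℝ (inChartL h p) (extChartAt I p p)) (w : E) :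
    contract (formAt g p) (fun u v => nabla g h p u v w) = ∑ i, nabla g h p (e i) (e i) w :=
  contract_formAt_eq he _ (fun v => (nabla_linear hg hh).1 v w)
    fun u => (nabla_linear hg hh).2.1 u w

theorem normSqNabla_eq_sum (hg : IsMetric g) (he : IsFrame (formAtL g p) e)
    (hh : DifferentiableAt ℝ (inChartL h p) (extChartAt I p p)) :
    normSqNabla g h p = ∑ i, ∑ j, ∑ k, nabla g h p (e i) (e j) (e k) ^ 2 := by
  obtain ⟨n₁, n₂, n₃⟩ := nabla_linear hg hh
  have l₃ : ∀ u u' v v', contract (formAt g p) (fun w w' =>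
      nabla g h p u v w * nabla g h p u' v' w')
      = ∑ k, nabla g h p u v (e k) * nabla g h p u' v' (e k) :=
    fun u u' v v' => contract_formAt_eq he _ (fun _ => isLinearMap_mul_const (n₃ u v) _)
      fun _ => isLinearMap_const_mul (n₃ u' v') _
  have l₂ : ∀ u u', contract (formAt g p) (fun v v' =>
      ∑ k, nabla g h p u v (e k) * nabla g h p u' v' (e k))
      = ∑ j, ∑ k, nabla g h p u (e j) (e k) * nabla g h p u' (e j) (e k) :=
    fun u u' => contract_formAt_eq he _
      (fun _ => isLinearMap_sum fun _ => isLinearMap_mul_const (n₂ u _) _)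
      fun _ => isLinearMap_sum fun _ => isLinearMap_const_mul (n₂ u' _) _
  simp only [normSqNabla, l₃, l₂, sq]
  exact contract_formAt_eq he _
    (fun _ => isLinearMap_sum fun _ => isLinearMap_sum fun _ => isLinearMap_mul_const (n₁ _ _) _)
    fun _ => isLinearMap_sum fun _ => isLinearMap_sum fun _ => isLinearMap_const_mul (n₁ _ _) _

end Geometry

/-! ### Geometry of products -/

section ProductGeometry

variable {E₁ : Type*} [NormedAddCommGroup E₁] [NormedSpace ℝ E₁]
  {H₁ : Type*} [TopologicalSpace H₁] {I₁ : ModelWithCorners ℝ E₁ H₁}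
  {M₁ : Type*} [TopologicalSpace M₁] [ChartedSpace H₁ M₁]
  {E₂ : Type*} [NormedAddCommGroup E₂] [NormedSpace ℝ E₂]
  {H₂ : Type*} [TopologicalSpace H₂] {I₂ : ModelWithCorners ℝ E₂ H₂}
  {M₂ : Type*} [TopologicalSpace M₂] [ChartedSpace H₂ M₂]
  {γ₁ : TensorField I₁ M₁} {γ₂ : TensorField I₂ M₂}

variable {ι₁ ι₂ : Type*} [Fintype ι₁] [Fintype ι₂] {p : M₁ × M₂} {e₁ : ι₁ → E₁} {e₂ : ι₂ → E₂}

theorem IsFrame.prod (he₁ : IsFrame (formAtL γ₁ p.1) e₁) (he₂ : IsFrame (formAtL γ₂ p.2) e₂) :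
    IsFrame (formAtL (productMetric γ₁ γ₂) p)
      (Sum.elim (fun i => (e₁ i, 0)) fun j => (0, e₂ j)) := by
  intro v
  have h : ∀ u, formAtL (productMetric γ₁ γ₂) p u v
      = formAtL γ₁ p.1 u.1 v.1 + formAtL γ₂ p.2 u.2 v.2 := fun u => rfl
  rw [Fintype.sum_sum_type]
  ext
  · simpa [h, Prod.fst_sum] using he₁ v.1
  · simpa [h, Prod.snd_sum] using he₂ v.2

/-- The tensor `a γ₁ + b γ₂` on a product of manifolds.  It destabilizes the cone if the weights
are chosen such that it is trace-free. -/
def productTensor (a b : ℝ) (γ₁ : TensorField I₁ M₁) (γ₂ : TensorField I₂ M₂) :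
    TensorField (I₁.prod I₂) (M₁ × M₂) :=
  productMetric (fun x => a • γ₁ x) fun x => b • γ₂ x

variable {a b : ℝ}

theorem formAtL_productTensor (u v : E₁ × E₂) : formAtL (productTensor a b γ₁ γ₂) p u v
    = a * formAtL γ₁ p.1 u.1 v.1 + b * formAtL γ₂ p.2 u.2 v.2 := rfl

/-- `Rm(g, g)` is the scalar curvature of `g`. -/
theorem sum_riemann_mul_self_of_isEinstein {E : Type*} [NormedAddCommGroup E] [NormedSpace ℝ E]
    [FiniteDimensional ℝ E] {H : Type*} [TopologicalSpace H] {I : ModelWithCorners ℝ E H}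
    {M : Type*} [TopologicalSpace M] [ChartedSpace H M] [IsManifold I ∞ M] {g : TensorField I M}
    (hg : IsMetric g) {c : ℝ} (hc : IsEinstein g c) {p : M} {ι : Type*} [Fintype ι] {e : ι → E}
    (he : IsFrame (formAtL g p) e) :
    ∑ i, ∑ j, ∑ k, ∑ l, riemann g p (e i) (e j) (e k) (e l)
      * formAtL g p (e i) (e k) * formAtL g p (e j) (e l) = c * Module.finrank ℝ E := by
  have s₁ : ∀ i j, ∑ k, ∑ l, riemann g p (e i) (e j) (e k) (e l)
      * formAtL g p (e i) (e k) * formAtL g p (e j) (e l) = riemann g p (e i) (e j) (e i) (e j) := by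
    intro i j
    have a₁ : ∀ k, ∑ l, formAtL g p (e l) (e j) * riemann g p (e i) (e j) (e k) (e l)
        = riemann g p (e i) (e j) (e k) (e j) := fun k =>
      he.sum_mul _ (hg.riemann_linear₄ p _ _ _) (e j)
    have a₂ : ∑ k, formAtL g p (e k) (e i) * riemann g p (e i) (e j) (e k) (e j)
        = riemann g p (e i) (e j) (e i) (e j) :=
      he.sum_mul (fun w => riemann g p (e i) (e j) w (e j)) (hg.riemann_linear₃ p _ _ _) (e i)
    rw [← a₂]
    refine Finset.sum_congr rfl fun k _ => ?_
    rw [← a₁ k, Finset.mul_sum]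
    refine Finset.sum_congr rfl fun l _ => ?_
    rw [hg.symm p (e l), hg.symm p (e k)]
    ring
  simp only [s₁]
  rw [Finset.sum_comm]
  simp only [← ricci_eq_sum hg he]
  have s₂ : ∀ v, ricci g p v v = c * formAtL g p v v := fun v => hc p v v
  simp only [s₂, ← Finset.mul_sum, he.sum_self]

variable [FiniteDimensional ℝ E₁] [FiniteDimensional ℝ E₂]

theorem sum_formAtL_sq {E : Type*} [NormedAddCommGroup E] [NormedSpace ℝ E]
    [FiniteDimensional ℝ E] {B : E →L[ℝ] E →L[ℝ] ℝ} {ι : Type*} [Fintype ι] {e : ι → E}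
    (he : IsFrame B e) :
    ∑ i, ∑ j, B (e i) (e j) ^ 2 = Module.finrank ℝ E := by
  rw [← he.sum_self, Finset.sum_comm]
  refine Finset.sum_congr rfl fun j _ => ?_
  simp only [sq]
  exact he.sum_mul (fun u => B u (e j)) (B.flip (e j)).toLinearMap.isLinear (e j)

theorem sum_productTensor_self (he₁ : IsFrame (formAtL γ₁ p.1) e₁)
    (he₂ : IsFrame (formAtL γ₂ p.2) e₂) :
    let e := Sum.elim (fun i => (e₁ i, (0 : E₂))) fun j => ((0 : E₁), e₂ j)
    ∑ i, formAtL (productTensor a b γ₁ γ₂) p (e i) (e i)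
      = a * Module.finrank ℝ E₁ + b * Module.finrank ℝ E₂ := by
  intro e
  simp [e, formAtL_productTensor, ← Finset.mul_sum, he₁.sum_self, he₂.sum_self]

theorem sum_productTensor_sq (he₁ : IsFrame (formAtL γ₁ p.1) e₁)
    (he₂ : IsFrame (formAtL γ₂ p.2) e₂) :
    let e := Sum.elim (fun i => (e₁ i, (0 : E₂))) fun j => ((0 : E₁), e₂ j)
    ∑ i, ∑ j, formAtL (productTensor a b γ₁ γ₂) p (e i) (e j) ^ 2
      = a ^ 2 * Module.finrank ℝ E₁ + b ^ 2 * Module.finrank ℝ E₂ := by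
  intro e
  simp [e, formAtL_productTensor, mul_pow, ← Finset.mul_sum, sum_formAtL_sq he₁,
    sum_formAtL_sq he₂]

variable [IsManifold I₁ ∞ M₁] [IsManifold I₂ ∞ M₂]

theorem inChartL_productTensor {y : E₁ × E₂} (hy : y ∈ (extChartAt (I₁.prod I₂) p).target) :
    inChartL (productTensor a b γ₁ γ₂) p y
      = prodForm (fun y => a • inChartL γ₁ p.1 y) (fun y => b • inChartL γ₂ p.2 y) y :=
  inChartL_productMetric _ _ p hy

theorem IsMetric.prod (h₁ : IsMetric γ₁) (h₂ : IsMetric γ₂) : IsMetric (productMetric γ₁ γ₂) := fun p => by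
  have h := (h₁ p.1).prod (h₂ p.2)
  have ht : (extChartAt (I₁.prod I₂) p).target
      = (extChartAt I₁ p.1).target ×ˢ (extChartAt I₂ p.2).target := by
    rw [extChartAt_prod]; rfl
  rw [← ht] at h
  exact h.congr fun y hy => inChartL_productMetric γ₁ γ₂ p hy

theorem contDiffOn_inChartL_productTensor (h₁ : IsMetric γ₁) (h₂ : IsMetric γ₂) (p : M₁ × M₂) :
    ContDiffOn ℝ ∞ (inChartL (productTensor a b γ₁ γ₂) p)
      (extChartAt (I₁.prod I₂) p).target := by
  refine ContDiffOn.congr ?_ fun y hy => inChartL_productTensor hy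
  rw [extChartAt_prod]
  refine contDiffOn_clm_apply.2 fun u => contDiffOn_clm_apply.2 fun v => ?_
  simp only [prodForm_apply, _root_.smul_apply]
  refine ContDiffOn.add (ContDiffOn.const_smul _ ?_) (ContDiffOn.const_smul _ ?_)
  · exact (((h₁ p.1).contDiffOn.comp contDiff_fst.contDiffOn fun y hy => hy.1).clm_apply
      contDiffOn_const).clm_apply contDiffOn_const
  · exact (((h₂ p.2).contDiffOn.comp contDiff_snd.contDiffOn fun y hy => hy.2).clm_apply
      contDiffOn_const).clm_apply contDiffOn_const

variable [I₁.Boundaryless] [I₂.Boundaryless]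

theorem IsMetric.riemann_prod (h₁ : IsMetric γ₁) (h₂ : IsMetric γ₂) (p : M₁ × M₂) (u v w z : E₁ × E₂) :
    riemann (productMetric γ₁ γ₂) p u v w z
      = riemann γ₁ p.1 u.1 v.1 w.1 z.1 + riemann γ₂ p.2 u.2 v.2 w.2 z.2 := by
  have e := inChart_eventuallyEq (p := p) fun y hy => inChartL_productMetric γ₁ γ₂ p hy
  have hy : extChartAt (I₁.prod I₂) p p = (extChartAt I₁ p.1 p.1, extChartAt I₂ p.2 p.2) := by
    rw [extChartAt_prod]; rfl
  rw [riemann, curvature_congr e, hy, (h₁ p.1).curvature_prod (h₂ p.2)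
    (mem_extChartAt_target p.1) (mem_extChartAt_target p.2)]
  rfl

theorem ricci_prod (h₁ : IsMetric γ₁) (h₂ : IsMetric γ₂) (v z : E₁ × E₂) :
    ricci (productMetric γ₁ γ₂) p v z = ricci γ₁ p.1 v.1 z.1 + ricci γ₂ p.2 v.2 z.2 := by
  obtain ⟨e₁, he₁⟩ := h₁.exists_frame p.1
  obtain ⟨e₂, he₂⟩ := h₂.exists_frame p.2
  rw [ricci_eq_sum (h₁.prod h₂) (he₁.prod he₂), ricci_eq_sum h₁ he₁, ricci_eq_sum h₂ he₂,
    Fintype.sum_sum_type]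
  simp [h₁.riemann_prod h₂, (h₁.riemann_linear₁ _ _ _ _).map_zero,
    (h₂.riemann_linear₁ _ _ _ _).map_zero]

/-- `a γ₁ + b γ₂` is parallel. -/
theorem nabla_productTensor (h₁ : IsMetric γ₁) (h₂ : IsMetric γ₂) (p : M₁ × M₂)
    (u v w : E₁ × E₂) :
    nabla (productMetric γ₁ γ₂) (productTensor a b γ₁ γ₂) p u v w = 0 := by
  have e := inChart_eventuallyEq (p := p) fun y hy => inChartL_productMetric γ₁ γ₂ p hy
  have e' := inChart_eventuallyEq (p := p) fun y hy =>
    inChartL_productTensor (γ₁ := γ₁) (γ₂ := γ₂) (a := a) (b := b) hy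
  have hy : extChartAt (I₁.prod I₂) p p = (extChartAt I₁ p.1 p.1, extChartAt I₂ p.2 p.2) := by
    rw [extChartAt_prod]; rfl
  rw [nabla, covariantDeriv_congr e e', hy]
  exact (h₁ p.1).covariantDeriv_prod (h₂ p.2)
    (mem_extChartAt_target p.1) (mem_extChartAt_target p.2) a b u v w

theorem rmQuadratic_productTensor (h₁ : IsMetric γ₁) (h₂ : IsMetric γ₂) {c : ℝ}
    (hc₁ : IsEinstein γ₁ c) (hc₂ : IsEinstein γ₂ c) (he₁ : IsFrame (formAtL γ₁ p.1) e₁)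
    (he₂ : IsFrame (formAtL γ₂ p.2) e₂) :
    rmQuadratic (productMetric γ₁ γ₂) (productTensor a b γ₁ γ₂) p
      = c * (a ^ 2 * Module.finrank ℝ E₁ + b ^ 2 * Module.finrank ℝ E₂) := by
  have z₁ := (h₁.riemann_linear₁ p.1 · · · |>.map_zero)
  have z₂ := (h₂.riemann_linear₁ p.2 · · · |>.map_zero)
  have z₃ := (h₁.riemann_linear₂ p.1 · · · |>.map_zero)
  have z₄ := (h₂.riemann_linear₂ p.2 · · · |>.map_zero)
  have r₁ := sum_riemann_mul_self_of_isEinstein h₁ hc₁ he₁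
  have r₂ := sum_riemann_mul_self_of_isEinstein h₂ hc₂ he₂
  rw [rmQuadratic_eq_sum (h₁.prod h₂) (he₁.prod he₂)]
  simp only [Fintype.sum_sum_type, Sum.elim_inl, Sum.elim_inr, formAtL_productTensor,
    h₁.riemann_prod h₂, map_zero, _root_.zero_apply, mul_zero, add_zero, zero_add,
    Finset.sum_const_zero, z₁, z₂, z₃, z₄, zero_mul]
  have t₁ : ∀ R x y : ℝ, R * (a * x) * (a * y) = a ^ 2 * (R * x * y) := fun _ _ _ => by ring
  have t₂ : ∀ R x y : ℝ, R * (b * x) * (b * y) = b ^ 2 * (R * x * y) := fun _ _ _ => by ring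
  simp only [t₁, t₂, ← Finset.mul_sum, r₁, r₂]
  ring

end ProductGeometry

/-! ### Geometry of cones -/

section ConeGeometry

variable {E : Type*} [NormedAddCommGroup E] [NormedSpace ℝ E]
  {H : Type*} [TopologicalSpace H] {I : ModelWithCorners ℝ E H}
  {M : Type*} [TopologicalSpace M] [ChartedSpace H M]
  {γ k : TensorField I M} {x : Cone M}

theorem extChartAt_cone_self (x : Cone M) :
    extChartAt (𝓘(ℝ, ℝ).prod I) x x = ((x.1 : ℝ), extChartAt I x.2 x.2) := by
  rw [extChartAt_prod]; rfl

theorem formAtL_coneMetric (u v : ℝ × E) : formAtL (coneMetric γ) x u v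
    = u.1 * v.1 + (x.1 : ℝ) ^ 2 * formAtL γ x.2 u.2 v.2 := rfl

theorem formAtL_radialTensor {f : ℝ → ℝ} (u v : ℝ × E) : formAtL (radialTensor f k) x u v
    = f x.1 * formAtL k x.2 u.2 v.2 := rfl

theorem Cone.pos {M : Type*} (x : Cone M) : 0 < (x.1 : ℝ) := x.1.2

variable {ι : Type*} [Fintype ι] {e : ι → E}

/-- The frame `∂_r, e_i / r` of the cone metric at a point at distance `r` from the tip. -/
def coneFrame (r : ℝ) (e : ι → E) : Option ι → ℝ × E :=
  fun i => i.elim (1, 0) fun i => (0, r⁻¹ • e i)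

theorem IsFrame.cone (he : IsFrame (formAtL γ x.2) e) :
    IsFrame (formAtL (coneMetric γ) x) (coneFrame x.1 e) := by
  intro v
  have hr := (Cone.pos x).ne'
  rw [Fintype.sum_option]
  ext
  · simp [coneFrame, formAtL_coneMetric, Prod.fst_sum]
  · simp only [coneFrame, formAtL_coneMetric, Prod.snd_sum, Option.elim_none, Option.elim_some,
      Prod.snd_add, Prod.smul_mk, smul_zero, zero_add, zero_mul, map_smul, _root_.smul_apply,
      smul_eq_mul, smul_smul]
    conv_rhs => rw [← he v.2]
    refine Finset.sum_congr rfl fun i _ => ?_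
    congr 1
    field_simp

theorem differentiableAt_inChartL [I.Boundaryless] {p : M}
    (hk : ContDiffOn ℝ ∞ (inChartL k p) (extChartAt I p).target) :
    DifferentiableAt ℝ (inChartL k p) (extChartAt I p p) :=
  (hk.contDiffAt (extChartAt_target_mem_nhds p)).differentiableAt (by simp)

variable [FiniteDimensional ℝ E] [IsManifold I ∞ M]

theorem IsMetric.cone (h : IsMetric γ) : IsMetric (coneMetric γ) := fun p => by
  have h' := (h p.2).cone
  rw [← extChartAt_cone_target] at h'
  exact h'.congr fun y hy => inChartL_coneMetric γ p hy

variable {f : ℝ → ℝ} {f' : ℝ}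

theorem contDiffOn_inChartL_radialTensor (hf : ContDiffOn ℝ ∞ f (Set.Ioi 0))
    (hk : ContDiffOn ℝ ∞ (inChartL k x.2) (extChartAt I x.2).target) :
    ContDiffOn ℝ ∞ (inChartL (radialTensor f k) x) (extChartAt (𝓘(ℝ, ℝ).prod I) x).target := by
  refine ContDiffOn.congr ?_ fun y hy => inChartL_radialTensor f k x hy
  rw [extChartAt_cone_target]
  refine contDiffOn_clm_apply.2 fun u => contDiffOn_clm_apply.2 fun v => ?_
  simp only [radialForm_apply]
  refine (hf.comp contDiff_fst.contDiffOn fun y hy => hy.1).mul ?_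
  exact ((hk.comp contDiff_snd.contDiffOn fun y hy => hy.2).clm_apply
    contDiffOn_const).clm_apply contDiffOn_const

variable [I.Boundaryless]

theorem IsMetric.riemann_cone (h : IsMetric γ) (x : Cone M) (u v w z : ℝ × E) :
    riemann (coneMetric γ) x u v w z
      = (x.1 : ℝ) ^ 2 * (riemann γ x.2 u.2 v.2 w.2 z.2
        - formAtL γ x.2 v.2 z.2 * formAtL γ x.2 u.2 w.2
        + formAtL γ x.2 u.2 z.2 * formAtL γ x.2 v.2 w.2) := by
  have e := inChart_eventuallyEq (p := x) fun y hy => inChartL_coneMetric γ x hy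
  have hc := (h x.2).curvature_cone (y := ((x.1 : ℝ), extChartAt I x.2 x.2)) (Cone.pos x)
    (mem_extChartAt_target x.2) u v z
  rw [riemann, curvature_congr e, extChartAt_cone_self, hc]
  refine (formAtL_coneMetric (γ := γ) (x := x) _ w).trans ?_
  have hr : ∀ u v w z : E, riemann γ x.2 u v w z = formAtL γ x.2
      (curvature (fun y u v => inChartL γ x.2 y u v) (extChartAt I x.2 x.2) u v z) w :=
    fun u v w z => rfl
  simp only [inChartL_self, hr]
  simp

/-- The Ricci curvature of the cone over an Einstein manifold of the right Einstein constant
vanishes. -/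
theorem isRicciFlat_coneMetric (h : IsMetric γ)
    (hγ : IsEinstein γ (Module.finrank ℝ E - 1)) : IsRicciFlat (coneMetric γ) := by
  intro x v z
  obtain ⟨e, he⟩ := h.exists_frame x.2
  have hr := (Cone.pos x).ne'
  rw [ricci_eq_sum h.cone he.cone, Fintype.sum_option]
  have l₁ := h.riemann_linear₁ x.2
  have l₃ := h.riemann_linear₃ x.2
  have hs : ∀ i, riemann (coneMetric γ) x (coneFrame x.1 e (some i)) v (coneFrame x.1 e (some i)) z
      = riemann γ x.2 (e i) v.2 (e i) z.2
        - formAtL γ x.2 v.2 z.2 * formAtL γ x.2 (e i) (e i)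
        + formAtL γ x.2 (e i) z.2 * formAtL γ x.2 (e i) v.2 := by
    intro i
    rw [h.riemann_cone]
    simp only [coneFrame, Option.elim_some, (l₁ _ _ _).map_smul, (l₃ _ _ _).map_smul, map_smul,
      _root_.smul_apply, smul_eq_mul, h.symm x.2 v.2 (e i)]
    field_simp
  have h0 : riemann (coneMetric γ) x (coneFrame x.1 e none) v (coneFrame x.1 e none) z = 0 := by
    rw [h.riemann_cone]
    simp [coneFrame, (l₁ _ _ _).map_zero]
  have hc := he.sum_mul (fun u => formAtL γ x.2 u v.2)
    ((formAtL γ x.2).flip v.2).toLinearMap.isLinear z.2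
  have hE : ricci γ x.2 v.2 z.2 = (Module.finrank ℝ E - 1) * formAtL γ x.2 v.2 z.2 := hγ _ _ _
  simp only [h0, hs, Finset.sum_add_distrib, Finset.sum_sub_distrib, ← Finset.mul_sum,
    he.sum_self, ← ricci_eq_sum h he, hE, hc, h.symm x.2 z.2 v.2]
  ring

theorem nabla_cone (h : IsMetric γ) (hf : HasDerivAt f f' x.1)
    (hk : DifferentiableAt ℝ (inChartL k x.2) (extChartAt I x.2 x.2))
    (hp : ∀ u v w, nabla γ k x.2 u v w = 0) (u v w : ℝ × E) :
    nabla (coneMetric γ) (radialTensor f k) x u v w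
      = u.1 * (f' - 2 * f x.1 / x.1) * formAtL k x.2 v.2 w.2
        - f x.1 / x.1 * (v.1 * formAtL k x.2 u.2 w.2 + w.1 * formAtL k x.2 v.2 u.2) := by
  have e := inChart_eventuallyEq (p := x) fun y hy => inChartL_coneMetric γ x hy
  have e' := inChart_eventuallyEq (p := x) fun y hy => inChartL_radialTensor f k x hy
  have hp' : ∀ u v w, covariantDeriv (fun y u v => inChartL γ x.2 y u v)
    (fun y u v => inChartL k x.2 y u v) (extChartAt I x.2 x.2) u v w = 0 := hp
  have hc := (h x.2).covariantDeriv_cone (y := ((x.1 : ℝ), extChartAt I x.2 x.2)) (Cone.pos x)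
    (mem_extChartAt_target x.2) hk hf u v w
  rw [nabla, covariantDeriv_congr e e', extChartAt_cone_self, hc, hp']
  simp only [inChartL_self]
  ring

theorem divergence_radialTensor (h : IsMetric γ) (hf : ContDiffOn ℝ ∞ f (Set.Ioi 0))
    (hk : ∀ p, ContDiffOn ℝ ∞ (inChartL k p) (extChartAt I p).target)
    (he : IsFrame (formAtL γ x.2) e) (hp : ∀ p u v w, nabla γ k p u v w = 0)
    (htr : ∑ i, formAtL k x.2 (e i) (e i) = 0) (w : ℝ × E) :
    contract (formAt (coneMetric γ) x)
      (fun u v => nabla (coneMetric γ) (radialTensor f k) x u v w) = 0 := by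
  have hf' := ((hf.contDiffAt (Ioi_mem_nhds (Cone.pos x))).differentiableAt (by simp)).hasDerivAt
  have hr := (Cone.pos x).ne'
  rw [divergence_eq_sum h.cone he.cone (differentiableAt_inChartL
    (contDiffOn_inChartL_radialTensor hf (hk x.2))), Fintype.sum_option]
  simp only [nabla_cone h hf' (differentiableAt_inChartL (hk x.2)) (hp x.2)]
  simp only [coneFrame, Option.elim_none, Option.elim_some, map_zero, map_smul,
    _root_.smul_apply, _root_.zero_apply, smul_eq_mul, mul_zero, zero_mul, add_zero, zero_add,
    sub_zero, zero_sub, Finset.sum_neg_distrib, ← Finset.mul_sum, htr, neg_zero]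

theorem normSqNabla_radialTensor (h : IsMetric γ) (hf : ContDiffOn ℝ ∞ f (Set.Ioi 0))
    (hk : ∀ p, ContDiffOn ℝ ∞ (inChartL k p) (extChartAt I p).target)
    (hp : ∀ p u v w, nabla γ k p u v w = 0) (he : IsFrame (formAtL γ x.2) e) :
    normSqNabla (coneMetric γ) (radialTensor f k) x
      = ((deriv f x.1 - 2 * f x.1 / x.1) ^ 2 + 2 * (f x.1 / x.1) ^ 2) / (x.1 : ℝ) ^ 4
        * ∑ i, ∑ j, formAtL k x.2 (e i) (e j) ^ 2 := by
  have hf' := ((hf.contDiffAt (Ioi_mem_nhds (Cone.pos x))).differentiableAt (by simp)).hasDerivAt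
  have hr := (Cone.pos x).ne'
  rw [normSqNabla_eq_sum h.cone he.cone (differentiableAt_inChartL
    (contDiffOn_inChartL_radialTensor hf (hk x.2)))]
  simp only [Fintype.sum_option, nabla_cone h hf' (differentiableAt_inChartL (hk x.2)) (hp x.2)]
  simp only [coneFrame, Option.elim_none, Option.elim_some, map_zero, map_smul,
    _root_.smul_apply, _root_.zero_apply, smul_eq_mul, mul_zero, zero_mul, add_zero, zero_add,
    sub_zero, zero_sub, one_mul, Finset.sum_const_zero, ne_eq, OfNat.ofNat_ne_zero,
    not_false_eq_true, zero_pow, mul_pow, neg_sq, sub_self, ← Finset.mul_sum,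
    Finset.sum_add_distrib]
  rw [Finset.sum_comm (f := fun i j => formAtL k x.2 (e j) (e i) ^ 2)]
  field_simp
  ring

theorem rmQuadratic_radialTensor (h : IsMetric γ) (he : IsFrame (formAtL γ x.2) e)
    (hs : ∀ u v, formAtL k x.2 u v = formAtL k x.2 v u) :
    rmQuadratic (coneMetric γ) (radialTensor f k) x
      = f x.1 ^ 2 / (x.1 : ℝ) ^ 6 * (rmQuadratic γ k x.2
        - (∑ i, formAtL k x.2 (e i) (e i)) ^ 2
        + ∑ i, ∑ j, formAtL k x.2 (e i) (e j) ^ 2) := by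
  have hr := (Cone.pos x).ne'
  have l₁ := h.riemann_linear₁ x.2
  have l₂ := h.riemann_linear₂ x.2
  have l₃ := h.riemann_linear₃ x.2
  have l₄ := h.riemann_linear₄ x.2
  set G := formAtL γ x.2
  set K := formAtL k x.2
  have t₁ : ∀ i, ∑ j, G (e j) (e i) * K (e i) (e j) = K (e i) (e i) := fun i =>
    he.sum_mul _ (K (e i)).toLinearMap.isLinear (e i)
  have t₂ : ∀ i j, ∑ l, G (e l) (e i) * K (e j) (e l) = K (e j) (e i) := fun i j =>
    he.sum_mul _ (K (e j)).toLinearMap.isLinear (e i)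
  have s₁ : ∑ i, ∑ j, ∑ k, ∑ l, (G (e l) (e j) * K (e j) (e l)) * (G (e k) (e i) * K (e i) (e k))
      = (∑ i, K (e i) (e i)) ^ 2 := by
    simp only [← Finset.sum_mul, t₁, ← Finset.mul_sum, sq]
  have s₂ : ∑ i, ∑ j, ∑ k, ∑ l, (G (e l) (e i) * K (e j) (e l)) * (G (e k) (e j) * K (e i) (e k))
      = ∑ i, ∑ j, K (e i) (e j) ^ 2 := by
    simp only [← Finset.sum_mul, t₂, ← Finset.mul_sum]
    refine Finset.sum_congr rfl fun i _ => Finset.sum_congr rfl fun j _ => ?_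
    rw [hs (e j), sq]
  rw [rmQuadratic_eq_sum h.cone he.cone, rmQuadratic_eq_sum h he, ← s₁, ← s₂]
  simp only [Fintype.sum_option, formAtL_radialTensor, h.riemann_cone]
  simp only [coneFrame, Option.elim_none, Option.elim_some, map_zero, map_smul,
    _root_.smul_apply, _root_.zero_apply, smul_eq_mul, mul_zero, zero_mul, zero_add,
    Finset.sum_const_zero, (l₁ _ _ _).map_smul, (l₂ _ _ _).map_smul, (l₃ _ _ _).map_smul,
    (l₄ _ _ _).map_smul]
  simp only [← Finset.sum_sub_distrib, ← Finset.sum_add_distrib]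
  simp only [Finset.mul_sum]
  refine Finset.sum_congr rfl fun i _ => Finset.sum_congr rfl fun j _ =>
    Finset.sum_congr rfl fun k _ => Finset.sum_congr rfl fun l _ => ?_
  rw [h.symm x.2 (e l) (e j), h.symm x.2 (e k) (e i), h.symm x.2 (e l) (e i),
    h.symm x.2 (e k) (e j)]
  field_simp
  ring

end ConeGeometry

/-! ### The Riemannian volume measure -/

section Volume

theorem gram_comp {E : Type*} [NormedAddCommGroup E] [NormedSpace ℝ E] [FiniteDimensional ℝ E]
    (B : E →L[ℝ] E →L[ℝ] ℝ) (A : E →L[ℝ] E) :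
    gram (fun u v => B (A u) (A v))
      = (LinearMap.toMatrix (Module.finBasis ℝ E) (Module.finBasis ℝ E) A.toLinearMap).transpose
        * gram (fun u v => B u v)
        * LinearMap.toMatrix (Module.finBasis ℝ E) (Module.finBasis ℝ E) A.toLinearMap := by
  set b := Module.finBasis ℝ E
  set P := LinearMap.toMatrix b b A.toLinearMap
  have hA : ∀ j, A (b j) = ∑ i, P i j • b i := fun j => by
    simp [P, LinearMap.toMatrix_apply, b.sum_repr]
  ext i j
  rw [Matrix.mul_apply]
  simp only [Matrix.mul_apply, Finset.sum_mul]
  simp only [gram, Matrix.of_apply, Matrix.transpose_apply]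
  change B (A (b i)) (A (b j)) = _
  rw [hA i, hA j]
  simp only [map_sum, map_smul, _root_.sum_apply, _root_.smul_apply, smul_eq_mul, Finset.mul_sum]
  refine Finset.sum_congr rfl fun k _ => Finset.sum_congr rfl fun l _ => ?_
  change _ = P l i * B (b l) (b k) * P k j
  ring

/-- The volume density `√det` of a bilinear form transforms with the determinant. -/
theorem sqrt_det_gram_comp {E : Type*} [NormedAddCommGroup E] [NormedSpace ℝ E]
    [FiniteDimensional ℝ E] (B : E →L[ℝ] E →L[ℝ] ℝ) (A : E →L[ℝ] E) :
    Real.sqrt (gram fun u v => B (A u) (A v)).det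
      = |A.det| * Real.sqrt (gram fun u v => B u v).det := by
  rw [gram_comp, Matrix.det_mul, Matrix.det_mul, Matrix.det_transpose, LinearMap.det_toMatrix,
    ← Real.sqrt_sq_eq_abs, ← Real.sqrt_mul (sq_nonneg _)]
  congr 1
  change _ = LinearMap.det A.toLinearMap ^ 2 * _
  ring

theorem _root_.ContinuousOn.measurableSet_inter_preimage {X Y : Type*} [TopologicalSpace X]
    [MeasurableSpace X] [BorelSpace X] [TopologicalSpace Y] [MeasurableSpace Y] [BorelSpace Y]
    {f : X → Y} {s : Set X} (hf : ContinuousOn f s) (hs : MeasurableSet s) {t : Set Y}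
    (ht : MeasurableSet t) : MeasurableSet (s ∩ f ⁻¹' t) := by
  have h := (continuousOn_iff_continuous_domRestrict.1 hf).measurable ht
  have h' := MeasurableSet.subtype_image hs h
  convert h' using 1
  ext x
  simp [and_comm]

variable {E : Type*} [NormedAddCommGroup E] [NormedSpace ℝ E]
  {H : Type*} [TopologicalSpace H] {I : ModelWithCorners ℝ E H}
  {M : Type*} [TopologicalSpace M] [ChartedSpace H M]

theorem measurableSet_image_extChartAt [I.Boundaryless] [MeasurableSpace E] [BorelSpace E]
    [MeasurableSpace M] [BorelSpace M] (p : M) {s : Set M} (hs : MeasurableSet s)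
    (hsp : s ⊆ (chartAt H p).source) : MeasurableSet (extChartAt I p '' s) := by
  rw [(extChartAt I p).image_eq_target_inter_inv_preimage (by rwa [extChartAt_source])]
  exact (continuousOn_extChartAt_symm p).measurableSet_inter_preimage
    (isOpen_extChartAt_target p).measurableSet hs

theorem disjoint_image_extChartAt (p : M) {s t : Set M} (hs : s ⊆ (chartAt H p).source)
    (ht : t ⊆ (chartAt H p).source) (h : Disjoint s t) :
    Disjoint (extChartAt I p '' s) (extChartAt I p '' t) := by
  rw [Set.disjoint_left] at h ⊢
  rintro _ ⟨z, hz, rfl⟩ ⟨z', hz', e⟩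
  rw [(extChartAt I p).injOn (by simpa using ht hz') (by simpa using hs hz) e] at hz'
  exact h hz hz'

variable [IsManifold I 1 M]

theorem chartDeriv_eq_tangentCoordChange (p : M) {z : M} (hz : z ∈ (chartAt H p).source) :
    chartDeriv I p (extChartAt I p z) = tangentCoordChange I p z z := by
  have h := TangentBundle.symmL_trivializationAt (I := I) hz
  rw [TangentBundle.symmL_trivializationAt_eq_core hz] at h
  exact h.symm

theorem inChartL_tangentCoordChange (T : TensorField I M) (p q : M) {z : M}
    (hp : z ∈ (chartAt H p).source) (hq : z ∈ (chartAt H q).source) (u v : E) :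
    inChartL T p (extChartAt I p z) u v = inChartL T q (extChartAt I q z)
      (tangentCoordChange I p q z u) (tangentCoordChange I p q z v) := by
  have hz : ∀ p, z ∈ (chartAt H p).source → ∀ u v : E, inChartL T p (extChartAt I p z) u v
      = T z (tangentCoordChange I p z z u) (tangentCoordChange I p z z v) := by
    intro p hp u v
    have h' : (extChartAt I p).symm (extChartAt I p z) = z :=
      (extChartAt I p).left_inv (by simpa using hp)
    have e2 : ∀ x', x' = z → ∀ a b : E, T x' a b = T z a b := by
      rintro _ rfl _ _
      rfl
    rw [← chartDeriv_eq_tangentCoordChange p hp]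
    exact e2 _ h' _ _
  have hc : ∀ u, tangentCoordChange I q z z (tangentCoordChange I p q z u)
      = tangentCoordChange I p z z u := fun u =>
    tangentCoordChange_comp ⟨⟨by simpa using hp, by simpa using hq⟩, mem_extChartAt_source z⟩
  rw [hz p hp, hz q hq, hc, hc]

variable [FiniteDimensional ℝ E] [MeasurableSpace E] [BorelSpace E]

/-- The density of the Riemannian volume in the preferred chart at `p`. -/
def volumeDensity (g : TensorField I M) (p : M) (y : E) : ENNReal :=
  ENNReal.ofReal (Real.sqrt (gram (inChart g p y)).det)

/-- The volume of a set contained in two charts does not depend on the chart. -/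
theorem lintegral_volumeDensity_eq [I.Boundaryless] [MeasurableSpace M] [BorelSpace M]
    (g : TensorField I M) (p q : M) {s : Set M}
    (hs : MeasurableSet s) (hp : s ⊆ (chartAt H p).source) (hq : s ⊆ (chartAt H q).source) :
    ∫⁻ y in extChartAt I p '' s, volumeDensity g p y ∂(Module.finBasis ℝ E).addHaar
      = ∫⁻ y in extChartAt I q '' s, volumeDensity g q y ∂(Module.finBasis ℝ E).addHaar := by
  have hinv : ∀ z ∈ s, (extChartAt I p).symm (extChartAt I p z) = z := fun z hz =>
    (extChartAt I p).left_inv (by simpa using hp hz)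
  have himg : extChartAt I q '' s
      = (extChartAt I q ∘ (extChartAt I p).symm) '' (extChartAt I p '' s) := by
    rw [Set.image_image]
    exact Set.image_congr fun z hz => by simp only [Function.comp_apply, hinv z hz]
  have hinj : Set.InjOn (extChartAt I q ∘ (extChartAt I p).symm) (extChartAt I p '' s) := by
    rintro _ ⟨z, hz, rfl⟩ _ ⟨z', hz', rfl⟩ h
    simp only [Function.comp_apply, hinv z hz, hinv z' hz'] at h
    rw [(extChartAt I q).injOn (by simpa using hq hz) (by simpa using hq hz') h]
  have hm := measurableSet_image_extChartAt (I := I) p hs hp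
  rw [himg, lintegral_image_eq_lintegral_abs_det_fderiv_mul _ hm
    (f' := fun y => tangentCoordChange I p q ((extChartAt I p).symm y)) ?_ hinj]
  · refine setLIntegral_congr_fun hm ?_
    rintro _ ⟨z, hz, rfl⟩
    have hB : inChart g p (extChartAt I p z) = fun u v => inChartL g q (extChartAt I q z)
        (tangentCoordChange I p q z u) (tangentCoordChange I p q z v) := by
      ext u v
      exact inChartL_tangentCoordChange g p q (hp hz) (hq hz) u v
    simp only [volumeDensity, Function.comp_apply, hinv z hz, hB]
    rw [sqrt_det_gram_comp, ENNReal.ofReal_mul (abs_nonneg _)]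
    rfl
  · rintro _ ⟨z, hz, rfl⟩
    simp only [hinv z hz]
    exact (hasFDerivWithinAt_tangentCoordChange
      ⟨by simpa using hp hz, by simpa using hq hz⟩).mono (by simp [I.range_eq_univ])

/-- The volume measures of countably many charts, restricted to disjoint pieces of `M`, add up to
the Riemannian volume. -/
theorem exists_isRiemannianVolume [I.Boundaryless] [MeasurableSpace M] [BorelSpace M]
    [SecondCountableTopology M] [Nonempty M] (g : TensorField I M) :
    ∃ μ : Measure M, IsRiemannianVolume g μ := by
  obtain ⟨C, hC, hCM⟩ := TopologicalSpace.countable_cover_nhds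
    fun x : M => (chartAt H x).open_source.mem_nhds (mem_chart_source H x)
  have hCne : C.Nonempty := by
    by_contra hne
    rw [Set.not_nonempty_iff_eq_empty] at hne
    exact Set.empty_ne_univ (by simpa [hne] using hCM)
  obtain ⟨c, rfl⟩ := hC.exists_eq_range hCne
  rw [Set.biUnion_range] at hCM
  let A : ℕ → Set M := disjointed fun k => (chartAt H (c k)).source
  have hAm : ∀ k, MeasurableSet (A k) := fun k =>
    MeasurableSet.disjointed (fun k => (chartAt H (c k)).open_source.measurableSet) k
  have hAs : ∀ k, A k ⊆ (chartAt H (c k)).source := fun k => disjointed_subset _ k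
  have hAd : Pairwise fun i j => Disjoint (A i) (A j) := disjoint_disjointed _
  have hAU : ⋃ k, A k = Set.univ := by rw [iUnion_disjointed, hCM]
  have hadd : ∀ (p : M) (f : ℕ → Set M), (∀ i, MeasurableSet (f i)) →
      (∀ i, f i ⊆ (chartAt H p).source) → (Pairwise fun i j => Disjoint (f i) (f j)) →
      ∫⁻ y in extChartAt I p '' ⋃ i, f i, volumeDensity g p y ∂(Module.finBasis ℝ E).addHaar
        = ∑' i, ∫⁻ y in extChartAt I p '' f i,
          volumeDensity g p y ∂(Module.finBasis ℝ E).addHaar := by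
    intro p f hf hfp hfd
    rw [Set.image_iUnion, lintegral_iUnion
      (fun i => measurableSet_image_extChartAt p (hf i) (hfp i))
      fun i j hij => disjoint_image_extChartAt p (hfp i) (hfp j) (hfd hij)]
  let m : ∀ s : Set M, MeasurableSet s → ENNReal := fun s _ =>
    ∑' k, ∫⁻ y in extChartAt I (c k) '' (s ∩ A k),
      volumeDensity g (c k) y ∂(Module.finBasis ℝ E).addHaar
  refine ⟨Measure.ofMeasurable m (by simp [m]) ?_, ?_⟩
  · intro f hf hd
    simp only [m]
    rw [ENNReal.tsum_comm]
    refine tsum_congr fun k => ?_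
    rw [Set.iUnion_inter, hadd (c k) _ (fun i => (hf i).inter (hAm k))
      (fun i => Set.inter_subset_right.trans (hAs k))
      fun i j hij => (hd hij).mono Set.inter_subset_left Set.inter_subset_left]
  · intro p s hs hsp
    rw [Measure.ofMeasurable_apply _ hs]
    change _ = ∫⁻ y in extChartAt I p '' s, volumeDensity g p y ∂(Module.finBasis ℝ E).addHaar
    have hsU : s = ⋃ k, s ∩ A k := by rw [← Set.inter_iUnion, hAU, Set.inter_univ]
    conv_rhs => rw [hsU]
    rw [hadd p _ (fun i => hs.inter (hAm i)) (fun i => Set.inter_subset_left.trans hsp)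
      fun i j hij => (hAd hij).mono Set.inter_subset_right Set.inter_subset_right]
    exact tsum_congr fun k => lintegral_volumeDensity_eq g _ _ (hs.inter (hAm k))
      (Set.inter_subset_right.trans (hAs k)) (Set.inter_subset_left.trans hsp)

/-- On a second countable manifold the junk value of `riemannianVolume` is not taken. -/
theorem isRiemannianVolume_riemannianVolume [I.Boundaryless] [MeasurableSpace M] [BorelSpace M]
    [SecondCountableTopology M] [Nonempty M] (g : TensorField I M) :
    IsRiemannianVolume g (riemannianVolume g) := by
  have h := exists_isRiemannianVolume g
  rw [riemannianVolume, dif_pos h]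
  exact h.choose_spec

end Volume

/-! ### Radial integration on cones -/

section RadialIntegration

theorem det_gram_pos {E : Type*} [NormedAddCommGroup E] [NormedSpace ℝ E] [FiniteDimensional ℝ E]
    {B : E →L[ℝ] E →L[ℝ] ℝ} (hs : ∀ u v, B u v = B v u) (hp : ∀ v, v ≠ 0 → 0 < B v v) :
    0 < (gram fun u v => B u v).det := by
  set b := Module.finBasis ℝ E
  refine (Matrix.PosDef.of_dotProduct_mulVec_pos (Matrix.IsHermitian.ext fun i j => hs _ _)
    fun x hx => ?_).det_pos
  have hv : ∑ i, x i • b i ≠ 0 := fun h => hx <| funext fun i =>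
    Fintype.linearIndependent_iff.1 b.linearIndependent x h i
  refine (hp _ hv).trans_eq ?_
  simp only [map_sum, map_smul, _root_.sum_apply, _root_.smul_apply, smul_eq_mul, dotProduct,
    Matrix.mulVec, Finset.mul_sum, star_trivial, Pi.star_apply]
  rw [Finset.sum_comm]
  refine Finset.sum_congr rfl fun i _ => Finset.sum_congr rfl fun j _ => ?_
  change _ = x i * (B (b i) (b j) * x j)
  ring

/-- The normalizing constant `κ` of the Lebesgue measures is left unspecified: the fixed basis of
`ℝ × E` is unrelated to the one of `E`. -/
theorem exists_addHaar_prod (E : Type*) [NormedAddCommGroup E] [NormedSpace ℝ E]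
    [FiniteDimensional ℝ E] [MeasurableSpace E] [BorelSpace E] :
    ∃ κ : ENNReal, κ ≠ 0 ∧ κ ≠ ⊤ ∧ (Module.finBasis ℝ (ℝ × E)).addHaar
      = κ • (volume : Measure ℝ).prod (Module.finBasis ℝ E).addHaar := by
  set ν := (volume : Measure ℝ).prod (Module.finBasis ℝ E).addHaar
  set lam := (Module.finBasis ℝ (ℝ × E)).addHaar
  refine ⟨lam.addHaarScalarFactor ν, ?_, ENNReal.coe_ne_top, ?_⟩
  · exact ENNReal.coe_ne_zero.2 (Measure.addHaarScalarFactor_pos_of_isAddHaarMeasure lam ν).ne'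
  · exact Measure.isAddLeftInvariant_eq_smul lam ν

variable {E : Type*} [NormedAddCommGroup E] [NormedSpace ℝ E] [FiniteDimensional ℝ E]
  {H : Type*} [TopologicalSpace H] {I : ModelWithCorners ℝ E H}
  {M : Type*} [TopologicalSpace M] [ChartedSpace H M] {γ : TensorField I M}

/-- The density of the cone metric at distance `1` from the tip. -/
def linkDensity (γ : TensorField I M) (p : M) (y : E) : ℝ :=
  Real.sqrt (gram fun u v => coneForm (inChartL γ p) (1, y) u v).det

theorem linkDensity_pos (h : IsMetric γ) (p : M) {y : E} (hy : y ∈ (extChartAt I p).target) :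
    0 < linkDensity γ p y :=
  have hy' : ((1 : ℝ), y) ∈ Set.Ioi (0 : ℝ) ×ˢ (extChartAt I p).target :=
    ⟨Set.mem_Ioi.2 one_pos, hy⟩
  Real.sqrt_pos.2 <| det_gram_pos ((h p).cone.symm _ hy') ((h p).cone.pos _ hy')

theorem continuousOn_linkDensity (h : IsMetric γ) (p : M) :
    ContinuousOn (linkDensity γ p) (extChartAt I p).target := by
  refine Real.continuous_sqrt.comp_continuousOn ?_
  have hc : ∀ u v, ContinuousOn (fun y => coneForm (inChartL γ p) (1, y) u v)
      (extChartAt I p).target := fun u v => by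
    simp only [coneForm_apply]
    exact continuousOn_const.add (continuousOn_const.mul
      (((h p).contDiffOn.continuousOn.clm_apply continuousOn_const).clm_apply continuousOn_const))
  simp only [Matrix.det_apply]
  exact continuousOn_finsetSum _ fun σ _ =>
    (continuousOn_finsetProd _ fun i _ => hc _ _).const_smul _

variable [IsManifold I ∞ M]

/-- The cone metric at distance `r` is the one at distance `1`, pulled back under `id × r`. -/
theorem volumeDensity_cone [I.Boundaryless] (γ : TensorField I M) (p : Cone M) {y : ℝ × E}
    (hy : y ∈ (extChartAt (𝓘(ℝ, ℝ).prod I) p).target) :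
    volumeDensity (coneMetric γ) p y
      = ENNReal.ofReal (y.1 ^ Module.finrank ℝ E) * ENNReal.ofReal (linkDensity γ p.2 y.2) := by
  have hr : 0 < y.1 := by
    rw [extChartAt_cone_target] at hy
    exact hy.1
  let A : ℝ × E →L[ℝ] ℝ × E :=
    (ContinuousLinearMap.id ℝ ℝ).prodMap (y.1 • ContinuousLinearMap.id ℝ E)
  have hA : A.det = y.1 ^ Module.finrank ℝ E := by
    change LinearMap.det (LinearMap.prodMap (LinearMap.id : ℝ →ₗ[ℝ] ℝ)
      (y.1 • (LinearMap.id : E →ₗ[ℝ] E))) = _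
    rw [LinearMap.det_prodMap, LinearMap.det_id, LinearMap.det_smul, LinearMap.det_id]
    ring
  have hB : inChart (coneMetric γ) p y
      = fun u v => coneForm (inChartL γ p.2) (1, y.2) (A u) (A v) := by
    ext u v
    change inChartL (coneMetric γ) p y u v = _
    rw [inChartL_coneMetric γ p hy]
    simp only [coneForm_apply]
    simp [A]
    ring
  rw [volumeDensity, hB, sqrt_det_gram_comp, hA, abs_of_nonneg (by positivity),
    ENNReal.ofReal_mul (by positivity)]
  rfl

variable [MeasurableSpace E] [BorelSpace E] [I.Boundaryless] [MeasurableSpace M] [BorelSpace M]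

/-- The volume of a product set over one chart of the link. -/
theorem volume_cone_box (h : IsMetric γ) {μ : Measure (Cone M)}
    (hμ : IsRiemannianVolume (coneMetric γ) μ) {κ : ENNReal}
    (hκ : (Module.finBasis ℝ (ℝ × E)).addHaar
      = κ • (volume : Measure ℝ).prod (Module.finBasis ℝ E).addHaar)
    (p : M) {A : Set ℝ} (hA : MeasurableSet A) {S : Set M} (hS : MeasurableSet S)
    (hSp : S ⊆ (chartAt H p).source) :
    μ {x | (x.1 : ℝ) ∈ A ∧ x.2 ∈ S}
      = (κ * ∫⁻ y in extChartAt I p '' S, ENNReal.ofReal (linkDensity γ p y)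
          ∂(Module.finBasis ℝ E).addHaar)
        * ∫⁻ r in A ∩ Set.Ioi 0, ENNReal.ofReal (r ^ Module.finrank ℝ E) := by
  let x₀ : Cone M := (⟨1, Set.mem_Ioi.2 one_pos⟩, p)
  have hm : MeasurableSet {x : Cone M | (x.1 : ℝ) ∈ A ∧ x.2 ∈ S} :=
    ((measurable_subtype_coe.comp measurable_fst) hA).inter (measurable_snd hS)
  have hsub : {x : Cone M | (x.1 : ℝ) ∈ A ∧ x.2 ∈ S}
      ⊆ (chartAt (ModelProd ℝ H) x₀).source := by
    intro x hx
    rw [← extChartAt_source (𝓘(ℝ, ℝ).prod I), extChartAt_prod, PartialEquiv.prod_source]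
    refine ⟨?_, by simpa using hSp hx.2⟩
    rw [extChartAt_source]
    change _ ∈ ((chartAt ℝ (x₀.1 : ℝ)).subtypeRestr ⟨x₀.1⟩).source
    rw [OpenPartialHomeomorph.subtypeRestr_source]
    exact Set.mem_univ _
  have himg : extChartAt (𝓘(ℝ, ℝ).prod I) x₀ '' {x : Cone M | (x.1 : ℝ) ∈ A ∧ x.2 ∈ S}
      = (A ∩ Set.Ioi 0) ×ˢ (extChartAt I p '' S) := by
    rw [extChartAt_prod]
    ext ⟨r, y⟩
    constructor
    · rintro ⟨x, hx, e⟩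
      obtain ⟨rfl, rfl⟩ := Prod.mk.inj e
      exact ⟨⟨hx.1, x.1.2⟩, x.2, hx.2, rfl⟩
    · rintro ⟨⟨hr, hr'⟩, z, hz, rfl⟩
      exact ⟨(⟨r, hr'⟩, z), ⟨hr, hz⟩, rfl⟩
  have hSm := measurableSet_image_extChartAt (I := I) p hS hSp
  have hAm : MeasurableSet (A ∩ Set.Ioi 0) := hA.inter measurableSet_Ioi
  have hSt : extChartAt I p '' S ⊆ (extChartAt I p).target := by
    rintro _ ⟨z, hz, rfl⟩
    exact (extChartAt I p).map_source (by simpa using hSp hz)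
  rw [hμ x₀ _ hm hsub, himg]
  have hd : ∀ y ∈ (A ∩ Set.Ioi 0) ×ˢ (extChartAt I p '' S),
      ENNReal.ofReal (Real.sqrt (gram (inChart (coneMetric γ) x₀ y)).det)
      = ENNReal.ofReal (y.1 ^ Module.finrank ℝ E) * ENNReal.ofReal (linkDensity γ p y.2) :=
    fun y hy => volumeDensity_cone γ x₀ (by
      rw [extChartAt_cone_target]
      exact ⟨hy.1.2, hSt hy.2⟩)
  have hm' : AEMeasurable (fun y => ENNReal.ofReal (linkDensity γ p y))
      ((Module.finBasis ℝ E).addHaar.restrict (extChartAt I p '' S)) :=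
    (((continuousOn_linkDensity h p).mono hSt).aemeasurable hSm).ennreal_ofReal
  rw [setLIntegral_congr_fun (hAm.prod hSm) hd, hκ, Measure.restrict_smul, lintegral_smul_measure,
    ← Measure.prod_restrict, lintegral_prod_mul (f := fun r : ℝ => ENNReal.ofReal
      (r ^ Module.finrank ℝ E)) (g := fun y => ENNReal.ofReal (linkDensity γ p y))
      (by fun_prop) hm', smul_eq_mul]
  ring

variable [CompactSpace M] [T2Space M] [Nonempty M]

/-- By compactness the link is a finite union of measurable sets that lie in charts. -/
theorem exists_volume_cone_eq (h : IsMetric γ) {μ : Measure (Cone M)}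
    (hμ : IsRiemannianVolume (coneMetric γ) μ) :
    ∃ c : ENNReal, c ≠ 0 ∧ c ≠ ⊤ ∧ ∀ A, MeasurableSet A → μ {x | (x.1 : ℝ) ∈ A}
      = c * ∫⁻ r in A ∩ Set.Ioi 0, ENNReal.ofReal (r ^ Module.finrank ℝ E) := by
  obtain ⟨κ, hκ0, hκt, hκ⟩ := exists_addHaar_prod E
  have key : ∃ S : Set M, Set.univ ⊆ S ∧ MeasurableSet S ∧ ∀ T ⊆ S, MeasurableSet T →
      ∃ c : ENNReal, c ≠ ⊤ ∧ ∀ A, MeasurableSet A → μ {x | (x.1 : ℝ) ∈ A ∧ x.2 ∈ T}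
        = c * ∫⁻ r in A ∩ Set.Ioi 0, ENNReal.ofReal (r ^ Module.finrank ℝ E) := by
    refine isCompact_univ.induction_on (p := fun R => ∃ S : Set M, R ⊆ S ∧ MeasurableSet S ∧
      ∀ T ⊆ S, MeasurableSet T → ∃ c : ENNReal, c ≠ ⊤ ∧ ∀ A, MeasurableSet A →
        μ {x | (x.1 : ℝ) ∈ A ∧ x.2 ∈ T}
        = c * ∫⁻ r in A ∩ Set.Ioi 0, ENNReal.ofReal (r ^ Module.finrank ℝ E)) ?_ ?_ ?_ ?_
    · refine ⟨∅, subset_rfl, MeasurableSet.empty, fun T hT _ => ⟨0, ENNReal.zero_ne_top, ?_⟩⟩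
      intro A _
      rw [Set.subset_empty_iff.1 hT]
      simp
    · rintro R R' hR ⟨S, hS, hS'⟩
      exact ⟨S, hR.trans hS, hS'⟩
    · rintro R R' ⟨S, hRS, hS, hc⟩ ⟨S', hRS', hS', hc'⟩
      refine ⟨S ∪ S', Set.union_subset_union hRS hRS', hS.union hS', fun T hT hTm => ?_⟩
      obtain ⟨c, hct, hcA⟩ := hc (T ∩ S) Set.inter_subset_right (hTm.inter hS)
      obtain ⟨c', hct', hcA'⟩ := hc' (T \ S)
        (fun z hz => (hT hz.1).resolve_left hz.2) (hTm.diff hS)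
      refine ⟨c + c', ENNReal.add_ne_top.2 ⟨hct, hct'⟩, fun A hA => ?_⟩
      rw [add_mul, ← hcA A hA, ← hcA' A hA, ← measure_union]
      · congr 1
        ext x
        by_cases hx : x.2 ∈ S <;> simp [hx]
      · rw [Set.disjoint_left]
        exact fun x hx hx' => hx'.2.2 hx.2.2
      · exact ((measurable_subtype_coe.comp measurable_fst) hA).inter
          (measurable_snd (hTm.diff hS))
    · intro p _
      obtain ⟨K, hK, hpK, hKp⟩ :=
        exists_compact_subset (chartAt H p).open_source (mem_chart_source H p)
      refine ⟨K, mem_nhdsWithin_of_mem_nhds (mem_interior_iff_mem_nhds.1 hpK), K, subset_rfl,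
        hK.measurableSet, fun T hT hTm => ⟨_, ?_, fun A hA =>
          volume_cone_box h hμ hκ p hA hTm (hT.trans hKp)⟩⟩
      refine ENNReal.mul_ne_top hκt ?_
      have hKs : K ⊆ (extChartAt I p).source := by rwa [extChartAt_source]
      have hK' : IsCompact (extChartAt I p '' K) :=
        hK.image_of_continuousOn ((continuousOn_extChartAt p).mono hKs)
      have hKt : extChartAt I p '' K ⊆ (extChartAt I p).target := by
        rintro _ ⟨z, hz, rfl⟩
        exact (extChartAt I p).map_source (hKs hz)
      obtain ⟨C, hC⟩ := hK'.exists_bound_of_continuousOn ((continuousOn_linkDensity h p).mono hKt)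
      refine ne_top_of_le_ne_top (b := ENNReal.ofReal C
        * (Module.finBasis ℝ E).addHaar (extChartAt I p '' K))
        (ENNReal.mul_ne_top ENNReal.ofReal_ne_top hK'.measure_lt_top.ne) ?_
      refine (lintegral_mono_set (Set.image_mono hT)).trans ?_
      rw [← setLIntegral_const]
      exact setLIntegral_mono' hK'.measurableSet fun y hy =>
        ENNReal.ofReal_le_ofReal ((le_abs_self _).trans (hC y hy))
  obtain ⟨S, hS, -, hc⟩ := key
  obtain ⟨c, hct, hcA⟩ := hc Set.univ hS MeasurableSet.univ
  refine ⟨c, ?_, hct, fun A hA => by simpa using hcA A hA⟩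
  -- A chart domain has positive volume.
  rintro rfl
  obtain ⟨p⟩ := ‹Nonempty M›
  have h0 : μ Set.univ = 0 := by simpa using hcA Set.univ MeasurableSet.univ
  have hb := volume_cone_box h hμ hκ p MeasurableSet.univ (chartAt H p).open_source.measurableSet
    subset_rfl
  rw [measure_mono_null (Set.subset_univ _) h0, eq_comm, mul_eq_zero, mul_eq_zero,
    ← extChartAt_source I, (extChartAt I p).image_source_eq_target] at hb
  rcases hb with (hb | hb) | hb
  · exact hκ0 hb
  · rw [setLIntegral_eq_zero_iff' (isOpen_extChartAt_target p).measurableSet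
      ((continuousOn_linkDensity h p).aemeasurable
        (isOpen_extChartAt_target p).measurableSet).ennreal_ofReal] at hb
    refine ((isOpen_extChartAt_target (I := I) p).measure_pos (Module.finBasis ℝ E).addHaar
      ⟨_, mem_extChartAt_target p⟩).ne' (measure_mono_null ?_ hb)
    intro y hy hy'
    exact (linkDensity_pos h p hy).not_ge (ENNReal.ofReal_eq_zero.1 (hy' hy))
  · rw [Set.univ_inter, setLIntegral_eq_zero_iff' measurableSet_Ioi (by fun_prop)] at hb
    refine ((isOpen_Ioi (a := (0 : ℝ))).measure_pos volume ⟨1, Set.mem_Ioi.2 one_pos⟩).ne'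
      (measure_mono_null ?_ hb)
    intro r hr hr'
    exact (pow_pos hr _).not_ge (ENNReal.ofReal_eq_zero.1 (hr' hr))

/-- Integration of radial functions over a cone with compact link.  The constant is the volume of
the link. -/
theorem exists_integral_cone_eq [SecondCountableTopology M] (h : IsMetric γ) {μ : Measure (Cone M)}
    (hμ : IsRiemannianVolume (coneMetric γ) μ) :
    ∃ c : ℝ, 0 < c ∧ ∀ F : ℝ → ℝ, Measurable F →
      ∫ x : Cone M, F x.1 ∂μ = c * ∫ r in Set.Ioi 0, r ^ Module.finrank ℝ E * F r := by
  obtain ⟨c, hc0, hct, hc⟩ := exists_volume_cone_eq h hμ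
  have hm : Measurable fun x : Cone M => (x.1 : ℝ) := measurable_subtype_coe.comp measurable_fst
  have hmap : μ.map (fun x : Cone M => (x.1 : ℝ)) = c • (volume.restrict (Set.Ioi 0)).withDensity
      fun r => ENNReal.ofReal (r ^ Module.finrank ℝ E) := by
    ext A hA
    rw [Measure.map_apply hm hA, Measure.smul_apply, withDensity_apply _ hA,
      Measure.restrict_restrict hA, smul_eq_mul, ← hc A hA]
    rfl
  refine ⟨c.toReal, ENNReal.toReal_pos hc0 hct, fun F hF => ?_⟩
  rw [← integral_map (φ := fun x : Cone M => (x.1 : ℝ)) hm.aemeasurable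
    hF.aestronglyMeasurable, hmap, integral_smul_measure,
    integral_withDensity_eq_integral_toReal_smul (by fun_prop) (by simp), smul_eq_mul]
  congr 1
  refine setIntegral_congr_fun measurableSet_Ioi fun r hr => ?_
  have hr' : (0 : ℝ) < r := hr
  simp only [smul_eq_mul]
  rw [ENNReal.toReal_ofReal (by positivity)]

end RadialIntegration

/-! ### The radial profile -/

section Profile

theorem integrable_sq {g : ℝ → ℝ} (hg : Continuous g) (hc : HasCompactSupport g) :
    Integrable fun s => g s ^ 2 := by
  refine (hg.pow 2).integrable_of_hasCompactSupport (hc.mono fun s hs => ?_)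
  exact fun h => hs (by simp [h])

/-- A wide bump function has small Dirichlet energy compared with its mass. -/
theorem exists_integral_sq_deriv_lt : ∃ χ : ℝ → ℝ, ContDiff ℝ ∞ χ ∧ HasCompactSupport χ ∧
    ∫ s, deriv χ s ^ 2 < ∫ s, χ s ^ 2 := by
  let b : ContDiffBump (0 : ℝ) := ⟨1, 2, one_pos, one_lt_two⟩
  have hb : ContDiff ℝ ∞ b := b.contDiff
  have hA : 0 < ∫ s, b s ^ 2 := by
    refine (hb.continuous.pow 2).integral_pos_of_hasCompactSupport_nonneg_nonzero
      (b.hasCompactSupport.comp_left (g := fun t : ℝ => t ^ 2) (by simp))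
      (fun s => sq_nonneg _) (x := 0) ?_
    simp [b.one_of_mem_closedBall (Metric.mem_closedBall_self b.rIn_pos.le)]
  obtain ⟨L, hL1, hL⟩ : ∃ L : ℝ, 1 ≤ L ∧ (∫ s, deriv b s ^ 2) < L * ∫ s, b s ^ 2 := by
    refine ⟨max 1 ((∫ s, deriv b s ^ 2) / (∫ s, b s ^ 2) + 1), le_max_left _ _, ?_⟩
    rw [← div_lt_iff₀ hA]
    exact (lt_add_one _).trans_le (le_max_right _ _)
  have hL0 : 0 < L := one_pos.trans_le hL1
  have hd : deriv (fun s => b (s / L)) = fun s => deriv b (s / L) / L := by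
    ext s
    have h := ((hb.differentiable (by simp)) (s / L)).hasDerivAt.comp s
      ((hasDerivAt_id s).div_const L)
    rw [show (fun s => b (s / L)) = b ∘ fun s => id s / L from rfl, h.deriv]
    simp [div_eq_mul_inv]
  refine ⟨fun s => b (s / L), hb.comp (contDiff_id.div_const L), ?_, ?_⟩
  · have := b.hasCompactSupport.comp_homeomorph (Homeomorph.mulRight₀ L⁻¹ (inv_ne_zero hL0.ne'))
    simpa [Function.comp_def, div_eq_mul_inv] using this
  · rw [hd]
    simp only [div_pow]
    rw [integral_div, Measure.integral_comp_div (fun s => deriv b s ^ 2) L,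
      Measure.integral_comp_div (fun s => b s ^ 2) L, abs_of_pos hL0, smul_eq_mul, smul_eq_mul,
      div_lt_iff₀ (by positivity)]
    nlinarith [mul_pos hL0 hA, mul_lt_mul_of_pos_left hL hL0, mul_pos hL0 (mul_pos hL0 hA)]

theorem integral_Ioi_eq_integral_exp (G : ℝ → ℝ) :
    ∫ r in Set.Ioi 0, G r = ∫ s, Real.exp s * G (Real.exp s) := by
  have h := integral_image_eq_integral_abs_deriv_smul MeasurableSet.univ
    (fun s _ => (Real.hasDerivAt_exp s).hasDerivWithinAt) Real.exp_injective.injOn G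
  rw [Set.image_univ, Real.range_exp, setIntegral_univ] at h
  simpa [abs_of_pos (Real.exp_pos _)] using h

/-- The energy density of `f = r² exp (-a s) χ(s)` in the coordinate `x = r = exp s`, where
`z = exp (-a s)`, `c = χ(s)`, and `c' = χ'(s)`. -/
theorem energy_density_exp {d : ℕ} {x z a c c' : ℝ} (hx : x ≠ 0) (h : x * x ^ d * z ^ 2 = x ^ 2) :
    x * (x ^ d * (((x * (2 * (z * c) + z * (c' - a * c)) - 2 * (x ^ 2 * (z * c)) / x) ^ 2
      + 2 * (x ^ 2 * (z * c) / x) ^ 2) / x ^ 4))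
      = c' ^ 2 + (a ^ 2 + 2) * c ^ 2 - a * (2 * c * c') := by
  have h1 : x * (2 * (z * c) + z * (c' - a * c)) - 2 * (x ^ 2 * (z * c)) / x
      = x * z * (c' - a * c) := by
    field_simp
    ring
  have h2 : x ^ 2 * (z * c) / x = x * z * c := by field_simp
  rw [h1, h2]
  calc _ = x * x ^ d * z ^ 2 * x ^ 2 / x ^ 4 * ((c' - a * c) ^ 2 + 2 * c ^ 2) := by ring
    _ = (c' - a * c) ^ 2 + 2 * c ^ 2 := by
      rw [h, ← pow_add, div_self (pow_ne_zero _ hx), one_mul]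
    _ = _ := by ring

theorem curvature_density_exp {d : ℕ} {x z c : ℝ} (hx : x ≠ 0) (h : x * x ^ d * z ^ 2 = x ^ 2) :
    x * (x ^ d * (2 * ((x ^ 2 * (z * c)) ^ 2 / x ^ 6 * d))) = 2 * d * c ^ 2 := by
  calc _ = x * x ^ d * z ^ 2 * x ^ 4 / x ^ 6 * (2 * d * c ^ 2) := by ring
    _ = _ := by rw [h, ← pow_add, div_self (pow_ne_zero _ hx), one_mul]

/-- In logarithmic coordinates `r = exp s`, and up to the weight `exp (-(d - 1) s / 2)`, the
profile is a wide bump `χ`.  The weight turns the inequality into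
`∫ χ'² < (d - 1) (9 - d) / 4 * ∫ χ²`: it is here that `d < 9` matters. -/
theorem exists_profile {d : ℕ} (hd : 2 ≤ d) (hd' : d ≤ 8) :
    ∃ f : ℝ → ℝ, ContDiffOn ℝ ∞ f (Set.Ioi 0) ∧ Measurable f ∧
      (∃ K ⊆ Set.Ioi (0 : ℝ), IsCompact K ∧ ∀ r, 0 < r → r ∉ K → f r = 0) ∧
      ∫ r in Set.Ioi 0, r ^ d * (((deriv f r - 2 * f r / r) ^ 2 + 2 * (f r / r) ^ 2) / r ^ 4)
        < ∫ r in Set.Ioi 0, r ^ d * (2 * (f r ^ 2 / r ^ 6 * d)) := by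
  obtain ⟨χ, hχ, hχc, hlt⟩ := exists_integral_sq_deriv_lt
  obtain ⟨a, ha⟩ : ∃ a : ℝ, a = (d - 1) / 2 := ⟨_, rfl⟩
  let ψ : ℝ → ℝ := fun s => Real.exp (-a * s) * χ s
  have hψ : ContDiff ℝ ∞ ψ := (Real.contDiff_exp.comp (contDiff_const.mul contDiff_id)).mul hχ
  have hχ' : ∀ s, HasDerivAt χ (deriv χ s) s := fun s =>
    (hχ.differentiable (by simp) s).hasDerivAt
  have hψ' : ∀ s, HasDerivAt ψ (Real.exp (-a * s) * (deriv χ s - a * χ s)) s := fun s => by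
    have h := (((hasDerivAt_id s).const_mul (-a)).exp).mul (hχ' s)
    refine h.congr_deriv ?_
    simp only [id]
    ring
  let f : ℝ → ℝ := fun r => r ^ 2 * ψ (Real.log r)
  have hf' : ∀ s, deriv f (Real.exp s)
      = Real.exp s * (2 * ψ s + Real.exp (-a * s) * (deriv χ s - a * χ s)) := fun s => by
    have hl := Real.hasDerivAt_log (Real.exp_pos s).ne'
    have h := (hasDerivAt_pow 2 (Real.exp s)).mul
      (HasDerivAt.comp (Real.exp s) (by rw [Real.log_exp]; exact hψ' s) hl)
    rw [show f = (fun r => r ^ 2) * (ψ ∘ Real.log) from rfl, h.deriv]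
    simp only [Function.comp, Real.log_exp]
    have := (Real.exp_pos s).ne'
    field_simp
    ring
  have hcont : Continuous (deriv χ) := hχ.continuous_deriv (by simp)
  have hχc' : HasCompactSupport (deriv χ) := hχc.deriv
  have i1 : Integrable fun s => χ s ^ 2 := integrable_sq hχ.continuous hχc
  have i2 : Integrable fun s => deriv χ s ^ 2 := integrable_sq hcont hχc'
  have hsq : ∀ s, HasDerivAt (fun s => χ s ^ 2) (2 * χ s * deriv χ s) s := fun s => by
    exact ((hχ' s).pow 2).congr_deriv (by simp)
  have i3 : Integrable fun s => 2 * χ s * deriv χ s :=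
    Continuous.integrable_of_hasCompactSupport (by have := hχ.continuous; fun_prop)
      hχc'.mul_left
  have h0 : ∫ s, 2 * χ s * deriv χ s = 0 := integral_eq_zero_of_hasDerivAt_of_integrable hsq i3 i1
  -- The weight `exp (2 a s)` of the cone cancels against the one in `ψ²`.
  have hw : ∀ s, Real.exp s * Real.exp s ^ d * Real.exp (-a * s) ^ 2 = Real.exp s ^ 2 := fun s => by
    rw [← Real.exp_nat_mul, ← Real.exp_nat_mul, ← Real.exp_nat_mul, ← Real.exp_add, ← Real.exp_add]
    congr 1
    rw [ha]
    push_cast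
    ring
  have e1 : ∫ r in Set.Ioi 0,
      r ^ d * (((deriv f r - 2 * f r / r) ^ 2 + 2 * (f r / r) ^ 2) / r ^ 4)
      = (∫ s, deriv χ s ^ 2) + (a ^ 2 + 2) * ∫ s, χ s ^ 2 := by
    rw [integral_Ioi_eq_integral_exp]
    have : ∀ s, Real.exp s * (Real.exp s ^ d * (((deriv f (Real.exp s)
        - 2 * f (Real.exp s) / Real.exp s) ^ 2 + 2 * (f (Real.exp s) / Real.exp s) ^ 2)
          / Real.exp s ^ 4))
        = deriv χ s ^ 2 + (a ^ 2 + 2) * χ s ^ 2 - a * (2 * χ s * deriv χ s) := fun s => by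
      rw [hf' s]
      simp only [f, ψ, Real.log_exp]
      exact energy_density_exp (Real.exp_pos s).ne' (hw s)
    simp only [this]
    have i4 : Integrable fun s => deriv χ s ^ 2 + (a ^ 2 + 2) * χ s ^ 2 := i2.add (i1.const_mul _)
    rw [integral_sub i4 (i3.const_mul _), integral_add i2 (i1.const_mul _),
      integral_const_mul, integral_const_mul, h0, mul_zero, sub_zero]
  have e2 : ∫ r in Set.Ioi 0, r ^ d * (2 * (f r ^ 2 / r ^ 6 * d)) = 2 * d * ∫ s, χ s ^ 2 := by
    rw [integral_Ioi_eq_integral_exp, ← integral_const_mul]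
    refine integral_congr_ae (.of_forall fun s => ?_)
    simp only [f, ψ, Real.log_exp]
    exact curvature_density_exp (Real.exp_pos s).ne' (hw s)
  refine ⟨f, ?_, ?_, ⟨Real.exp '' tsupport χ, ?_, hχc.image Real.continuous_exp, ?_⟩, ?_⟩
  · exact (contDiffOn_id.pow 2).mul (hψ.comp_contDiffOn
      (Real.contDiffOn_log.mono fun r (hr : 0 < r) => hr.ne'))
  · exact (measurable_id.pow_const 2).mul (hψ.continuous.measurable.comp Real.measurable_log)
  · rintro _ ⟨s, -, rfl⟩
    exact Real.exp_pos s
  · intro r hr hrK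
    have : χ (Real.log r) = 0 := by
      refine image_eq_zero_of_notMem_tsupport fun h => hrK ⟨_, h, Real.exp_log hr⟩
    simp [f, ψ, this]
  · rw [e1, e2]
    have hA : 0 ≤ ∫ s, χ s ^ 2 := integral_nonneg fun s => sq_nonneg _
    have h1 : (2 : ℝ) ≤ d := by exact_mod_cast hd
    have h2 : (d : ℝ) ≤ 8 := by exact_mod_cast hd'
    have h3 : 1 ≤ 2 * d - (a ^ 2 + 2) := by
      rw [ha]
      nlinarith [mul_nonneg (sub_nonneg.2 h1) (sub_nonneg.2 h2)]
    nlinarith [mul_le_mul_of_nonneg_right h3 hA]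

end Profile

/-! ### Instability of cones -/

section Instability

variable {E : Type*} [NormedAddCommGroup E] [NormedSpace ℝ E] [FiniteDimensional ℝ E]
  {H : Type*} [TopologicalSpace H] {I : ModelWithCorners ℝ E H} [I.Boundaryless]
  {M : Type*} [TopologicalSpace M] [ChartedSpace H M] [IsManifold I ∞ M] [CompactSpace M]
  [T2Space M] {γ k : TensorField I M}

theorem isVariation_radialTensor {f : ℝ → ℝ} (hf : ContDiffOn ℝ ∞ f (Set.Ioi 0))
    {K : Set ℝ} (hK : K ⊆ Set.Ioi 0) (hKc : IsCompact K) (hfK : ∀ r, 0 < r → r ∉ K → f r = 0)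
    (hk : ∀ p, ContDiffOn ℝ ∞ (inChartL k p) (extChartAt I p).target)
    (hs : ∀ p u v, formAtL k p u v = formAtL k p v u) :
    IsVariation (radialTensor f k) where
  smooth := (contMDiff_iff_contDiffOn_inChartL _).2 fun p =>
    contDiffOn_inChartL_radialTensor hf (hk p.2)
  symm x u v := congrArg (f x.1 * ·) (hs x.2 _ _)
  compactSupport := by
    have hK' : IsCompact ((Subtype.val : posReals → ℝ) ⁻¹' K) := by
      refine Topology.IsInducing.subtypeVal.isCompact_preimage' hKc ?_
      rw [Subtype.range_coe]
      exact hK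
    refine (hK'.prod isCompact_univ).closure_of_subset fun x hx => ⟨?_, Set.mem_univ _⟩
    by_contra hxK
    refine hx ?_
    rw [radialTensor, hfK x.1 x.1.2 hxK]
    exact zero_smul ℝ _

/-- A cone of dimension at most `9` is unstable as soon as its link carries a parallel trace-free
tensor `k` of constant norm on which the curvature of the link acts as for an Einstein metric
of the constant that makes the cone Ricci-flat, `Rm(k, k) = (dim - 1) |k|²`. -/
theorem not_isStable_coneMetric [MeasurableSpace E] [BorelSpace E] [MeasurableSpace M]
    [BorelSpace M] [SecondCountableTopology M] [Nonempty M] (h : IsMetric γ)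
    (hd : 2 ≤ Module.finrank ℝ E) (hd' : Module.finrank ℝ E ≤ 8)
    (hk : ∀ p, ContDiffOn ℝ ∞ (inChartL k p) (extChartAt I p).target)
    (hs : ∀ p u v, formAtL k p u v = formAtL k p v u)
    (hp : ∀ p u v w, nabla γ k p u v w = 0) {N : ℝ} (hN : 0 < N) {ι : Type*} [Fintype ι]
    {e : M → ι → E} (he : ∀ p, IsFrame (formAtL γ p) (e p))
    (htr : ∀ p, ∑ i, formAtL k p (e p i) (e p i) = 0)
    (hn : ∀ p, ∑ i, ∑ j, formAtL k p (e p i) (e p j) ^ 2 = N)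
    (hrm : ∀ p, rmQuadratic γ k p = (Module.finrank ℝ E - 1) * N) :
    ¬ IsStable (coneMetric γ) := by
  intro hst
  obtain ⟨f, hf, hfm, ⟨K, hK, hKc, hfK⟩, hlt⟩ := exists_profile hd hd'
  have : SecondCountableTopology (Cone M) := inferInstance
  have : Nonempty (Cone M) := ⟨(⟨1, Set.mem_Ioi.2 one_pos⟩, Classical.arbitrary M)⟩
  obtain ⟨c, hc, hint⟩ :=
    exists_integral_cone_eq h (isRiemannianVolume_riemannianVolume (coneMetric γ))
  have hle := hst (radialTensor f k) (isVariation_radialTensor hf hK hKc hfK hk hs)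
    fun x w => divergence_radialTensor h hf hk (he x.2) hp (htr x.2) w
  have e1 : ∀ x : Cone M, 2 * rmQuadratic (coneMetric γ) (radialTensor f k) x
      = N * (2 * (f x.1 ^ 2 / (x.1 : ℝ) ^ 6 * Module.finrank ℝ E)) := fun x => by
    rw [rmQuadratic_radialTensor h (he x.2) (hs x.2), hrm, htr, hn]
    ring
  have e2 : ∀ x : Cone M, normSqNabla (coneMetric γ) (radialTensor f k) x
      = N * (((deriv f x.1 - 2 * f x.1 / x.1) ^ 2 + 2 * (f x.1 / x.1) ^ 2) / (x.1 : ℝ) ^ 4) :=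
    fun x => by
      rw [normSqNabla_radialTensor h hf hk hp (he x.2), hn]
      ring
  simp only [e1, e2] at hle
  have hfm' := measurable_deriv f
  rw [integral_const_mul N, integral_const_mul N,
    hint (fun r => 2 * (f r ^ 2 / r ^ 6 * Module.finrank ℝ E)) (by fun_prop),
    hint (fun r => ((deriv f r - 2 * f r / r) ^ 2 + 2 * (f r / r) ^ 2) / r ^ 4)
      (by fun_prop)] at hle
  exact hle.not_gt (mul_lt_mul_of_pos_left (mul_lt_mul_of_pos_left hlt hc) hN)

end Instability

theorem isMetric_inner {E : Type*} [NormedAddCommGroup E] [NormedSpace ℝ E]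
    [FiniteDimensional ℝ E] {H : Type*} [TopologicalSpace H] {I : ModelWithCorners ℝ E H}
    [I.Boundaryless] {M : Type*} [TopologicalSpace M] [ChartedSpace H M] [IsManifold I ∞ M]
    (γ : ContMDiffRiemannianMetric I ∞ E (fun x : M => TangentSpace I x)) : IsMetric γ.inner :=
  isMetric_of_contMDiff γ.contMDiff γ.symm γ.pos

end RiemannianCone

end

theorem mainTheorem2
    (n n₁ n₂ : ℕ) (hn₁ : 0 < n₁) (hn₂ : 0 < n₂) (hn : n = n₁ + n₂ + 1)
    {M₁ : Type*} [TopologicalSpace M₁] [ChartedSpace (EuclideanSpace ℝ (Fin n₁)) M₁]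
    [IsManifold (𝓡 n₁) ∞ M₁] [T2Space M₁] [CompactSpace M₁] [Nonempty M₁]
    [MeasurableSpace M₁] [BorelSpace M₁]
    {M₂ : Type*} [TopologicalSpace M₂] [ChartedSpace (EuclideanSpace ℝ (Fin n₂)) M₂]
    [IsManifold (𝓡 n₂) ∞ M₂] [T2Space M₂] [CompactSpace M₂] [Nonempty M₂]
    [MeasurableSpace M₂] [BorelSpace M₂]
    (γ₁ : ContMDiffRiemannianMetric (𝓡 n₁) ∞ (EuclideanSpace ℝ (Fin n₁))
      (fun x : M₁ => TangentSpace (𝓡 n₁) x))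
    (γ₂ : ContMDiffRiemannianMetric (𝓡 n₂) ∞ (EuclideanSpace ℝ (Fin n₂))
      (fun x : M₂ => TangentSpace (𝓡 n₂) x))
    (hγ₁ : RiemannianCone.IsEinstein γ₁.inner ((n : ℝ) - 2))
    (hγ₂ : RiemannianCone.IsEinstein γ₂.inner ((n : ℝ) - 2))
    (hdim : n < 10) :
    RiemannianCone.IsRicciFlat
        (RiemannianCone.coneMetric (RiemannianCone.productMetric γ₁.inner γ₂.inner)) ∧
      ¬ RiemannianCone.IsStable
        (RiemannianCone.coneMetric (RiemannianCone.productMetric γ₁.inner γ₂.inner)) := by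
  have h₁ := RiemannianCone.isMetric_inner γ₁
  have h₂ := RiemannianCone.isMetric_inner γ₂
  have : SecondCountableTopology M₁ :=
    ChartedSpace.secondCountable_of_sigmaCompact (EuclideanSpace ℝ (Fin n₁)) M₁
  have : SecondCountableTopology M₂ :=
    ChartedSpace.secondCountable_of_sigmaCompact (EuclideanSpace ℝ (Fin n₂)) M₂
  have hf : Module.finrank ℝ (EuclideanSpace ℝ (Fin n₁) × EuclideanSpace ℝ (Fin n₂)) = n₁ + n₂ := by
    simp
  have hc : (n : ℝ) - 2 = Module.finrank ℝ
      (EuclideanSpace ℝ (Fin n₁) × EuclideanSpace ℝ (Fin n₂)) - 1 := by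
    rw [hf, hn]
    push_cast
    ring
  refine ⟨RiemannianCone.isRicciFlat_coneMetric (h₁.prod h₂) fun p v w => ?_, ?_⟩
  · rw [RiemannianCone.ricci_prod h₁ h₂, hγ₁, hγ₂, ← hc, ← mul_add]
    rfl
  choose e₁ he₁ using h₁.exists_frame
  choose e₂ he₂ using h₂.exists_frame
  have hN : 0 < (n₂ : ℝ) ^ 2 * n₁ + (-(n₁ : ℝ)) ^ 2 * n₂ := by positivity
  refine RiemannianCone.not_isStable_coneMetric
    (k := RiemannianCone.productTensor n₂ (-n₁) γ₁.inner γ₂.inner) (h₁.prod h₂)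
    (hf.symm ▸ by omega) (hf.symm ▸ by omega)
    (RiemannianCone.contDiffOn_inChartL_productTensor h₁ h₂) (fun p u v => ?_)
    (RiemannianCone.nabla_productTensor h₁ h₂) hN
    (e := fun p => Sum.elim (fun i => (e₁ p.1 i, 0)) fun j => (0, e₂ p.2 j))
    (fun p => (he₁ p.1).prod (he₂ p.2)) (fun p => ?_) (fun p => ?_) fun p => ?_
  · rw [RiemannianCone.formAtL_productTensor, RiemannianCone.formAtL_productTensor,
      h₁.symm, h₂.symm]
  · rw [RiemannianCone.sum_productTensor_self (he₁ p.1) (he₂ p.2)]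
    simp
    ring
  · rw [RiemannianCone.sum_productTensor_sq (he₁ p.1) (he₂ p.2)]
    simp
  · rw [RiemannianCone.rmQuadratic_productTensor h₁ h₂ hγ₁ hγ₂ (he₁ p.1) (he₂ p.2), hc]
    simp
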